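/- Let $\mathbf{k}$ be a field. A filtered dg-algebra $(A,d,F)$ is a $\mathbb{Z}$-graded associative (not necessarily unital) $\mathbf{k}$-algebra $A=\bigoplus_n A^n$ with a differential $d$ of degree $1$ satisfying $d^2=0$ and the graded Leibniz rule, and a decreasing filtration with $F^pA^n\subseteq A^n$, $d(F^pA^n)\subseteq F^pA^{n+1}$ and $F^pA\cdot F^qA\subseteq F^{p+q}A$, which is exhaustive ($A^n=\bigcup_p F^pA^n$ for all $n$) and bounded below (for every $n$ there is $p$ with $F^pA^n=0$). **Theorem.** For every integer $r\ge 0$, every filtered dg-algebra $(A,d,F)$ over $\mathbf{k}$ has an $E_r$-minimal $A_\infty$-model. That is, there are an $A_\infty$-algebra $(M,d,\nu_s)_{s\geq 2}$ over $\mathbf{k}$ with a bigrading $M=\bigoplus_{p,q\in\mathbb{Z}} M^{p,q}$ (where $M^{p,q}$ has degree $p+q$) such that $$d(M^{p,q})\subseteq \bigoplus_{k\geq 0}M^{p+r+k+1,\,q-r-k}$$ and, for all $s\ge 2$, $$\nu_s(M^{p_1,q_1}\otimes\cdots\otimes M^{p_s,q_s})\subseteq \bigoplus_{k\geq 0}M^{p_1+\cdots+p_s+(2-s)r+k,\;q_1+\cdots+q_s+(2-s)(1-r)-k},$$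 and a morphism of $A_\infty$-algebras $f=(f_s)_{s\ge 1}:M\to A$ with, for all $s\geq 1$, $$f_s(M^{p_1,q_1}\otimes\cdots\otimes M^{p_s,q_s})\subseteq F^{p_1+\cdots+p_s+(1-s)r}A^{p_1+\cdots+p_s+q_1+\cdots+q_s-s+1},$$ such that $E_r(f_1):(E_r(M),d_r)\to (E_r(A),d_r)$ is a quasi-isomorphism of complexes. Here $E_r$ denotes the $r$-th page of the spectral sequence of a filtered complex, and $M$ carries the filtration $F^pM^n=\bigoplus_{q\ge p}M^{q,n-q}$. -/

import Mathlib

universe u v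

/-! ### Filtered complexes and the pages of their spectral sequence -/

/-- A cochain complex with a decreasing filtration, written internally: `d` is an endomorphism of
the total space `V`, and `Fil p n` is the subspace `F^p V^n` of `V`. -/
structure FilteredComplex (k : Type*) [Field k] (V : Type*) [AddCommGroup V] [Module k V] where
  d : V →ₗ[k] V
  Fil : ℤ → ℤ → Submodule k V
  d_d : ∀ x, d (d x) = 0
  d_mem : ∀ p n x, x ∈ Fil p n → d x ∈ Fil p (n + 1)
  anti : ∀ n, Antitone fun p => Fil p n

namespace FilteredComplex

variable {k : Type*} [Field k] {V W : Type*} [AddCommGroup V] [Module k V]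
  [AddCommGroup W] [Module k W]

/-- `Z_r^p` in total degree `n`: the elements of `F^p V^n` with differential in `F^{p+r}`. -/
def Z (X : FilteredComplex k V) (r p n : ℤ) : Submodule k V :=
  X.Fil p n ⊓ (X.Fil (p + r) (n + 1)).comap X.d

/-- `Z_{r-1}^{p+1} + d Z_{r-1}^{p-r+1}` in total degree `n`. -/
def B (X : FilteredComplex k V) (r p n : ℤ) : Submodule k V :=
  X.Z (r - 1) (p + 1) n ⊔ (X.Z (r - 1) (p - r + 1) (n - 1)).map X.d

/-- The term `E_r^{p,n-p} = Z_r^p / (Z_{r-1}^{p+1} + d Z_{r-1}^{p-r+1})` of the spectral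
sequence; here `n` is the total degree. For `r = 0` it is `F^p V^n / F^{p+1} V^n`. -/
abbrev Page (X : FilteredComplex k V) (r p n : ℤ) : Type _ :=
  X.Z r p n ⧸ (X.B r p n).submoduleOf (X.Z r p n)

theorem d_mem_Z (X : FilteredComplex k V) {r p n p' n' : ℤ} (hp : p + r = p') (hn : n + 1 = n')
    (x : V) (hx : x ∈ X.Z r p n) : X.d x ∈ X.Z r p' n' := by
  subst hp hn
  refine ⟨hx.2, ?_⟩
  simp [X.d_d]

theorem d_mem_B (X : FilteredComplex k V) {r p n p' n' : ℤ} (hp : p + r = p') (hn : n + 1 = n')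
    (x : V) (hx : x ∈ X.B r p n) : X.d x ∈ X.B r p' n' := by
  subst hp hn
  obtain ⟨y, hy, z, hz, rfl⟩ := Submodule.mem_sup.1 hx
  obtain ⟨w, -, rfl⟩ := hz
  refine Submodule.mem_sup_right ⟨y, ?_, by simp [X.d_d]⟩
  have e1 : p + r - r + 1 = p + 1 := by ring
  have e2 : n + 1 - 1 = n := by ring
  rw [e1, e2]
  exact hy

/-- The differential `d_r : E_r^{p,q} → E_r^{p+r,q-r+1}`, induced by `d`. -/
def pageD (X : FilteredComplex k V) (r p n p' n' : ℤ) (hp : p + r = p') (hn : n + 1 = n') :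
    X.Page r p n →ₗ[k] X.Page r p' n' :=
  Submodule.mapQ _ _ (X.d.restrict (X.d_mem_Z hp hn)) fun x hx => X.d_mem_B hp hn x.1 hx

/-- The cocycles of `(E_r, d_r)` at position `(p, n - p)`. -/
def pageCocycles (X : FilteredComplex k V) (r p n : ℤ) : Submodule k (X.Page r p n) :=
  LinearMap.ker (X.pageD r p n (p + r) (n + 1) rfl rfl)

/-- The coboundaries of `(E_r, d_r)` at position `(p, n - p)`. -/
def pageCoboundaries (X : FilteredComplex k V) (r p n : ℤ) : Submodule k (X.Page r p n) :=
  LinearMap.range (X.pageD r (p - r) (n - 1) p n (by ring) (by ring))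

/-- The cohomology of `(E_r, d_r)` at position `(p, n - p)`. -/
abbrev PageCohomology (X : FilteredComplex k V) (r p n : ℤ) : Type _ :=
  X.pageCocycles r p n ⧸ (X.pageCoboundaries r p n).submoduleOf (X.pageCocycles r p n)

/-- A morphism of filtered complexes. -/
structure Hom (X : FilteredComplex k V) (Y : FilteredComplex k W) where
  f : V →ₗ[k] W
  comm : ∀ x, f (X.d x) = Y.d (f x)
  map_mem : ∀ p n x, x ∈ X.Fil p n → f x ∈ Y.Fil p n

namespace Hom

variable {X : FilteredComplex k V} {Y : FilteredComplex k W}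

theorem map_mem_Z (φ : Hom X Y) (r p n : ℤ) (x : V) (hx : x ∈ X.Z r p n) :
    φ.f x ∈ Y.Z r p n := by
  refine ⟨φ.map_mem _ _ _ hx.1, ?_⟩
  simpa [← φ.comm] using φ.map_mem _ _ _ hx.2

theorem map_mem_B (φ : Hom X Y) (r p n : ℤ) (x : V) (hx : x ∈ X.B r p n) :
    φ.f x ∈ Y.B r p n := by
  obtain ⟨y, hy, z, ⟨w, hw, rfl⟩, rfl⟩ := Submodule.mem_sup.1 hx
  rw [map_add, φ.comm]
  exact add_mem (Submodule.mem_sup_left (φ.map_mem_Z _ _ _ _ hy))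
    (Submodule.mem_sup_right ⟨_, φ.map_mem_Z _ _ _ _ hw, rfl⟩)

/-- The induced map `E_r(φ) : E_r^{p,n-p}(X) → E_r^{p,n-p}(Y)`. -/
def pageMap (φ : Hom X Y) (r p n : ℤ) : X.Page r p n →ₗ[k] Y.Page r p n :=
  Submodule.mapQ _ _ (φ.f.restrict (φ.map_mem_Z r p n)) fun x hx => φ.map_mem_B r p n x.1 hx

theorem pageMap_pageD (φ : Hom X Y) (r p n p' n' : ℤ) (hp : p + r = p') (hn : n + 1 = n')
    (x : X.Page r p n) :
    φ.pageMap r p' n' (X.pageD r p n p' n' hp hn x) =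
      Y.pageD r p n p' n' hp hn (φ.pageMap r p n x) := by
  obtain ⟨x, rfl⟩ := Submodule.Quotient.mk_surjective _ x
  refine congrArg (Submodule.Quotient.mk (p := (Y.B r p' n').submoduleOf (Y.Z r p' n'))) ?_
  exact Subtype.ext (φ.comm x.1)

theorem pageMap_mem_cocycles (φ : Hom X Y) (r p n : ℤ) (x : X.Page r p n)
    (hx : x ∈ X.pageCocycles r p n) : φ.pageMap r p n x ∈ Y.pageCocycles r p n := by
  have hx' : X.pageD r p n (p + r) (n + 1) rfl rfl x = 0 := hx
  change Y.pageD r p n (p + r) (n + 1) rfl rfl _ = 0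
  rw [← φ.pageMap_pageD, hx', map_zero]

theorem pageMap_mem_coboundaries (φ : Hom X Y) (r p n : ℤ) (x : X.Page r p n)
    (hx : x ∈ X.pageCoboundaries r p n) : φ.pageMap r p n x ∈ Y.pageCoboundaries r p n := by
  obtain ⟨y, rfl⟩ := hx
  exact ⟨_, (φ.pageMap_pageD _ _ _ _ _ _ _ y).symm⟩

/-- The map induced by `E_r(φ)` on the cohomology of the complexes `(E_r, d_r)`. -/
def pageCohomologyMap (φ : Hom X Y) (r p n : ℤ) :
    X.PageCohomology r p n →ₗ[k] Y.PageCohomology r p n :=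
  Submodule.mapQ _ _ ((φ.pageMap r p n).restrict (φ.pageMap_mem_cocycles r p n))
    fun x hx => φ.pageMap_mem_coboundaries r p n x.1 hx

/-- `E_r(φ) : (E_r(X), d_r) → (E_r(Y), d_r)` is a quasi-isomorphism of complexes. -/
def IsPageQuasiIso (φ : Hom X Y) (r : ℤ) : Prop :=
  ∀ p n, Function.Bijective (φ.pageCohomologyMap r p n)

end Hom

end FilteredComplex

/-! ### A-infinity algebras and their morphisms -/

/-- In the sequence `a`, replace the `s` entries in positions `r, …, r + s - 1` by the single
entry `x`: the result is `a 0, …, a (r - 1), x, a (r + s), a (r + s + 1), …`. -/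
def graft {V : Type*} (a : ℕ → V) (r s : ℕ) (x : V) (i : ℕ) : V :=
  if i < r then a i else if i = r then x else a (i + s - 1)

/-- A (non-unital, `ℤ`-graded, cohomological) `A_∞`-algebra with underlying space `V`. The grading
is internal; `m n` is the operation of arity `n ≥ 1`, of degree `2 - n`, and `m 1` is the
differential. The identities are
`∑_{r+s+t=n, s≥1} (-1)^{r+st} m_{r+1+t} (1^{⊗r} ⊗ m_s ⊗ 1^{⊗t}) = 0` for `n ≥ 1`,
evaluated on homogeneous elements with the Koszul sign rule: moving `m_s` past
`a 0, …, a (r - 1)` gives the sign `(-1)^{s (deg a_0 + ⋯ + deg a_{r-1})}`. -/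
structure AInfAlgebra (k : Type*) [Field k] (V : Type*) [AddCommGroup V] [Module k V] where
  gr : ℤ → Submodule k V
  isInternal : DirectSum.IsInternal gr
  m : ∀ n : ℕ, MultilinearMap k (fun _ : Fin n => V) V
  m_zero : m 0 = 0
  m_mem : ∀ (n : ℕ) (a : Fin n → V) (deg : Fin n → ℤ), (∀ i, a i ∈ gr (deg i)) →
    m n a ∈ gr (∑ i, deg i + 2 - n)
  stasheff : ∀ (n : ℕ), 1 ≤ n → ∀ (a : ℕ → V) (deg : ℕ → ℤ), (∀ i, a i ∈ gr (deg i)) →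
    ∑ r ∈ Finset.range n, ∑ s ∈ Finset.Icc 1 (n - r),
      ((r : ℤ) + s * (n - r - s : ℕ) + s * ∑ i ∈ Finset.range r, deg i).negOnePow •
        m (n + 1 - s) (fun i => graft a r s (m s fun j => a (r + j)) i) = 0

namespace AInfAlgebra

variable {k : Type*} [Field k] {V W : Type*} [AddCommGroup V] [Module k V]
  [AddCommGroup W] [Module k W]

/-- The differential of an `A_∞`-algebra: the operation of arity one. -/
def d (X : AInfAlgebra k V) : V →ₗ[k] V :=
  (MultilinearMap.ofSubsingleton k V V (0 : Fin 1)).symm (X.m 1)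

theorem d_d_of_mem (X : AInfAlgebra k V) {n : ℤ} {x : V} (hx : x ∈ X.gr n) :
    X.d (X.d x) = 0 := by
  have h := X.stasheff 1 le_rfl (fun _ => x) (fun _ => n) (fun _ => hx)
  simp only [Finset.range_one, Finset.sum_singleton, Nat.sub_zero, Finset.Icc_self] at h
  rw [smul_eq_zero_iff_eq] at h
  rw [← h]
  change X.m 1 (fun _ => X.m 1 fun _ => x) = _
  congr 1
  funext i
  simp [graft]

theorem linearMap_ext_gr (X : AInfAlgebra k V) {f g : V →ₗ[k] W}
    (h : ∀ n, ∀ x ∈ X.gr n, f x = g x) : f = g := by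
  have htop := X.isInternal.submodule_iSup_eq_top
  ext x
  have hx : x ∈ ⨆ n, X.gr n := by rw [htop]; trivial
  induction hx using Submodule.iSup_induction' with
  | mem i x hx => exact h i x hx
  | zero => simp
  | add x y _ _ hx hy => simp [hx, hy]

theorem d_d (X : AInfAlgebra k V) (x : V) : X.d (X.d x) = 0 := by
  have h : X.d ∘ₗ X.d = 0 := X.linearMap_ext_gr fun n x hx => by
    simpa using X.d_d_of_mem hx
  exact LinearMap.congr_fun h x

/-- A morphism of `A_∞`-algebras: maps `f n` of arity `n ≥ 1` and degree `1 - n` such that, for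
all `n ≥ 1`,
`∑_{r+s+t=n, s≥1} (-1)^{r+st} f_{r+1+t} (1^{⊗r} ⊗ m_s ⊗ 1^{⊗t}) =
  ∑_{i_1+⋯+i_l=n} (-1)^ε m_l (f_{i_1} ⊗ ⋯ ⊗ f_{i_l})`, with
`ε = (l-1)(i_1-1) + (l-2)(i_2-1) + ⋯ + (i_{l-1}-1)`,
evaluated on homogeneous elements with the Koszul sign rule (moving `f_{i_j}`, of degree
`1 - i_j`, past the arguments of the preceding blocks). -/
structure Hom (X : AInfAlgebra k V) (Y : AInfAlgebra k W) where
  f : ∀ n : ℕ, MultilinearMap k (fun _ : Fin n => V) W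
  f_zero : f 0 = 0
  f_mem : ∀ (n : ℕ) (a : Fin n → V) (deg : Fin n → ℤ), (∀ i, a i ∈ X.gr (deg i)) →
    f n a ∈ Y.gr (∑ i, deg i + 1 - n)
  relation : ∀ (n : ℕ), 1 ≤ n → ∀ (a : ℕ → V) (deg : ℕ → ℤ), (∀ i, a i ∈ X.gr (deg i)) →
    ∑ r ∈ Finset.range n, ∑ s ∈ Finset.Icc 1 (n - r),
      ((r : ℤ) + s * (n - r - s : ℕ) + s * ∑ i ∈ Finset.range r, deg i).negOnePow •
        f (n + 1 - s) (fun i => graft a r s (X.m s fun j => a (r + j)) i) =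
    ∑ c : Composition n,
      (∑ j : Fin c.length, ((c.length : ℤ) - 1 - j) * (c.blocksFun j - 1) +
        ∑ j : Fin c.length, (1 - (c.blocksFun j : ℤ)) *
          ∑ i ∈ Finset.range (c.sizeUpTo j), deg i).negOnePow •
        Y.m c.length (fun j => f (c.blocksFun j) fun i => a (c.sizeUpTo j + i))

namespace Hom

variable {X : AInfAlgebra k V} {Y : AInfAlgebra k W}

/-- The linear part `f_1` of a morphism of `A_∞`-algebras. -/
def linearPart (φ : Hom X Y) : V →ₗ[k] W :=
  (MultilinearMap.ofSubsingleton k V W (0 : Fin 1)).symm (φ.f 1)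

theorem linearPart_d (φ : Hom X Y) (x : V) :
    φ.linearPart (X.d x) = Y.d (φ.linearPart x) := by
  have h : φ.linearPart ∘ₗ X.d = Y.d ∘ₗ φ.linearPart := X.linearMap_ext_gr fun n x hx => by
    have h := φ.relation 1 le_rfl (fun _ => x) (fun _ => n) (fun _ => hx)
    have hc : (Finset.univ : Finset (Composition 1)) = {Composition.single 1 one_pos} := by
      refine Finset.eq_singleton_iff_unique_mem.2 ⟨Finset.mem_univ _, fun c _ => ?_⟩
      exact Finset.card_le_one.1 (by simp [composition_card]) _ (Finset.mem_univ _) _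
        (Finset.mem_univ _)
    rw [hc] at h
    simp only [Finset.range_one, Finset.sum_singleton, Nat.sub_zero, Finset.Icc_self] at h
    have e1 : (((0 : ℕ) : ℤ) + (1 : ℕ) * (1 - 1 : ℕ) +
        (1 : ℕ) * ∑ i ∈ Finset.range 0, (fun _ => n) i) = 0 := by simp
    rw [e1, Int.negOnePow_zero, one_smul] at h
    have e2 : (fun i : Fin (1 + 1 - 1) =>
        graft (fun _ => x) 0 1 (X.m 1 fun _ => x) (i : ℕ)) = fun _ => X.m 1 fun _ => x := by
      funext i
      simp [graft]
    rw [e2] at h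
    refine Eq.trans (h : φ.f 1 (fun _ => X.m 1 fun _ => x) = _) ?_
    change _ = Y.m 1 (fun _ => φ.f 1 fun _ => x)
    have e3 : (∑ j : Fin (Composition.single 1 one_pos).length,
          (((Composition.single 1 one_pos).length : ℤ) - 1 - j) *
            ((Composition.single 1 one_pos).blocksFun j - 1) +
        ∑ j : Fin (Composition.single 1 one_pos).length,
          (1 - ((Composition.single 1 one_pos).blocksFun j : ℤ)) *
          ∑ i ∈ Finset.range ((Composition.single 1 one_pos).sizeUpTo j), (fun _ => n) i) = 0 := by
      simp
    have e4 : ∀ (l : ℕ) (_ : l = 1) (b : Fin l → ℕ) (_ : ∀ j, b j = 1),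
        Y.m l (fun j => φ.f (b j) fun _ => x) = Y.m 1 (fun _ => φ.f 1 fun _ => x) := by
      rintro l rfl b hb
      refine congrArg _ (funext fun j => ?_)
      rw [hb j]
    rw [e3, Int.negOnePow_zero, one_smul]
    exact e4 _ (Composition.single_length one_pos) _ (Composition.single_blocksFun one_pos)
  exact LinearMap.congr_fun h x

end Hom

end AInfAlgebra

/-! ### Filtered dg-algebras -/

/-- The structure of a filtered dg-algebra on an associative `k`-algebra `A` (a unit is not
required): an internal grading `gr n = A^n`, a differential satisfying the graded Leibniz rule, and
a decreasing multiplicative filtration `Fil p n = F^p A^n` by subcomplexes, which is exhaustive and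
bounded below, i.e. in each degree `n` one has `F^p A^n = 0` for some `p`. -/
structure FilteredDGAlgebra (k : Type*) [Field k] (A : Type*) [NonUnitalRing A] [Module k A] where
  gr : ℤ → Submodule k A
  isInternal : DirectSum.IsInternal gr
  mul_mem : ∀ m n x y, x ∈ gr m → y ∈ gr n → x * y ∈ gr (m + n)
  d : A →ₗ[k] A
  d_mem : ∀ n x, x ∈ gr n → d x ∈ gr (n + 1)
  d_d : ∀ x, d (d x) = 0
  leibniz : ∀ n x y, x ∈ gr n → d (x * y) = d x * y + n.negOnePow • (x * d y)
  Fil : ℤ → ℤ → Submodule k A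
  Fil_le : ∀ p n, Fil p n ≤ gr n
  Fil_anti : ∀ n, Antitone fun p => Fil p n
  Fil_exhaustive : ∀ n x, x ∈ gr n → ∃ p, x ∈ Fil p n
  Fil_bounded : ∀ n, ∃ p, Fil p n = ⊥
  Fil_d : ∀ p n x, x ∈ Fil p n → d x ∈ Fil p (n + 1)
  Fil_mul : ∀ p q m n x y, x ∈ Fil p m → y ∈ Fil q n → x * y ∈ Fil (p + q) (m + n)

namespace FilteredDGAlgebra

variable {k : Type*} [Field k] {A : Type*} [NonUnitalRing A] [Module k A]

/-- The underlying filtered complex. -/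
def toFilteredComplex (X : FilteredDGAlgebra k A) : FilteredComplex k A where
  d := X.d
  Fil := X.Fil
  d_d := X.d_d
  d_mem := X.Fil_d
  anti := X.Fil_anti

variable [IsScalarTower k A A] [SMulCommClass k A A]

/-- The operations of a dg-algebra viewed as an `A_∞`-algebra: `m_1 = d`, `m_2` is the product,
and `m_n = 0` for `n ≥ 3`. -/
def op (X : FilteredDGAlgebra k A) : ∀ n : ℕ, MultilinearMap k (fun _ : Fin n => A) A
  | 0 => 0
  | 1 => MultilinearMap.ofSubsingleton k A A (0 : Fin 1) X.d
  | 2 =>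
    { toFun := fun v => v 0 * v 1
      map_update_add' := fun v i x y => by
        fin_cases i <;> simp [Function.update, add_mul, mul_add]
      map_update_smul' := fun v i c x => by
        fin_cases i <;> simp [Function.update, smul_mul_assoc, mul_smul_comm] }
  | _ + 3 => 0

theorem op_eq_zero (X : FilteredDGAlgebra k A) {n : ℕ} (hn : 3 ≤ n) : X.op n = 0 := by
  obtain ⟨m, rfl⟩ := Nat.exists_eq_add_of_le' hn
  rfl

theorem op_mem (X : FilteredDGAlgebra k A) (n : ℕ) (a : Fin n → A) (deg : Fin n → ℤ)
    (h : ∀ i, a i ∈ X.gr (deg i)) : X.op n a ∈ X.gr (∑ i, deg i + 2 - n) := by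
  match n, a, deg, h with
  | 0, a, deg, h => exact zero_mem _
  | 1, a, deg, h =>
    have e : ∑ i, deg i + 2 - ((1 : ℕ) : ℤ) = deg 0 + 1 := by simp; ring
    rw [e]
    exact X.d_mem _ _ (h 0)
  | 2, a, deg, h =>
    have e : ∑ i, deg i + 2 - ((2 : ℕ) : ℤ) = deg 0 + deg 1 := by simp
    rw [e]
    exact X.mul_mem _ _ _ _ (h 0) (h 1)
  | n + 3, a, deg, h => exact zero_mem _

theorem op_stasheff (X : FilteredDGAlgebra k A) (n : ℕ) (hn : 1 ≤ n) (a : ℕ → A) (deg : ℕ → ℤ)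
    (h : ∀ i, a i ∈ X.gr (deg i)) :
    ∑ r ∈ Finset.range n, ∑ s ∈ Finset.Icc 1 (n - r),
      ((r : ℤ) + s * (n - r - s : ℕ) + s * ∑ i ∈ Finset.range r, deg i).negOnePow •
        X.op (n + 1 - s) (fun i => graft a r s (X.op s fun j => a (r + j)) i) = 0 := by
  have h1 : ∀ v, X.op 1 v = X.d (v 0) := fun v => rfl
  have h2 : ∀ v, X.op 2 v = v 0 * v 1 := fun v => rfl
  rcases (by omega : n = 1 ∨ n = 2 ∨ n = 3 ∨ 4 ≤ n) with rfl | rfl | rfl | hn4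
  · simp [h1, graft, X.d_d]
  · have e : Finset.Icc 1 2 = {1, 2} := rfl
    have hl := X.leibniz _ _ (a 1) (h 0)
    simp [Finset.sum_range_succ, e, h1, h2, graft, hl, Int.negOnePow_add]
  · have e : Finset.Icc 1 2 = {1, 2} := rfl
    have e' : Finset.Icc 1 3 = {1, 2, 3} := rfl
    have h3 : X.op 3 = 0 := rfl
    have e4 : Int.negOnePow 2 = 1 := rfl
    have e5 : Int.negOnePow (1 + 2 * deg 0) = -1 := by
      rw [add_comm, Int.negOnePow_two_mul_add_one]
    have h1z : (X.op 1) (fun _ => (0 : A)) = 0 := by rw [h1, map_zero]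
    simp [Finset.sum_range_succ, e, e', h2, h3, graft, mul_assoc, e4, e5, h1z]
  · refine Finset.sum_eq_zero fun r hr => Finset.sum_eq_zero fun s hs => ?_
    rw [Finset.mem_range] at hr
    rw [Finset.mem_Icc] at hs
    rcases le_or_gt 3 s with h3 | h3
    · rw [(X.op (n + 1 - s)).map_coord_zero ⟨r, by omega⟩, smul_zero]
      simp [graft, X.op_eq_zero h3]
    · rw [X.op_eq_zero (n := n + 1 - s) (by omega)]
      simp

/-- A filtered dg-algebra, viewed as an `A_∞`-algebra. -/
def toAInfAlgebra (X : FilteredDGAlgebra k A) : AInfAlgebra k A where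
  gr := X.gr
  isInternal := X.isInternal
  m := X.op
  m_zero := rfl
  m_mem := X.op_mem
  stasheff := X.op_stasheff

end FilteredDGAlgebra

/-! ### Minimal models -/

/-- The column filtration `F^p M^n = ⨁_{q ≥ p} M^{q,n-q}` of a bigraded space. -/
def columnFiltration {k : Type*} [Field k] {M : Type*} [AddCommGroup M] [Module k M]
    (bigr : ℤ × ℤ → Submodule k M) (p n : ℤ) : Submodule k M :=
  ⨆ q : ℤ, ⨆ _ : p ≤ q, bigr (q, n - q)

/-- An `A_∞`-algebra `(M, d, ν_i)` with a bigrading `M = ⨁ M^{p,q}` (the degree of `M^{p,q}` being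
`p + q`) whose differential and operations satisfy the bidegree conditions
`d(M^{p,q}) ⊆ ⨁_{j≥0} M^{p+r+j+1, q-r-j}` and, for `s ≥ 2`,
`ν_s(M^{p_1,q_1} ⊗ ⋯ ⊗ M^{p_s,q_s}) ⊆ ⨁_{j≥0} M^{∑p_i+(2-s)r+j, ∑q_i+(2-s)(1-r)-j}`. -/
structure ErMinimalAlgebra (k : Type*) [Field k] (r : ℕ) (M : Type*) [AddCommGroup M]
    [Module k M] extends AInfAlgebra k M where
  bigr : ℤ × ℤ → Submodule k M
  bigr_isInternal : DirectSum.IsInternal bigr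
  gr_eq : ∀ n, gr n = ⨆ p : ℤ, bigr (p, n - p)
  d_bidegree : ∀ (p q : ℤ) (x : M), x ∈ bigr (p, q) →
    toAInfAlgebra.d x ∈ ⨆ j : ℕ, bigr (p + r + j + 1, q - r - j)
  m_bidegree : ∀ (s : ℕ), 2 ≤ s → ∀ (p q : Fin s → ℤ) (a : Fin s → M),
    (∀ i, a i ∈ bigr (p i, q i)) →
      m s a ∈ ⨆ j : ℕ, bigr (∑ i, p i + (2 - s) * r + j, ∑ i, q i + (2 - s) * (1 - r) - j)

namespace ErMinimalAlgebra

variable {k : Type*} [Field k] {r : ℕ} {M : Type*} [AddCommGroup M] [Module k M]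

/-- The complex `(M, d)` with the column filtration. -/
def toFilteredComplex (X : ErMinimalAlgebra k r M) : FilteredComplex k M where
  d := X.toAInfAlgebra.d
  Fil := columnFiltration X.bigr
  d_d := X.toAInfAlgebra.d_d
  d_mem := fun p n x hx => by
    have key : columnFiltration X.bigr p n ≤
        (columnFiltration X.bigr p (n + 1)).comap X.toAInfAlgebra.d := by
      refine iSup₂_le fun q hq y hy => ?_
      have hle : (⨆ j : ℕ, X.bigr (q + r + j + 1, n - q - r - j)) ≤
          columnFiltration X.bigr p (n + 1) := by
        refine iSup_le fun j => ?_
        have e : n - q - r - j = n + 1 - (q + r + j + 1) := by ring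
        rw [e]
        exact le_iSup₂_of_le (f := fun q (_ : p ≤ q) => X.bigr (q, n + 1 - q))
          (q + r + j + 1) (by omega) le_rfl
      exact hle (X.d_bidegree q (n - q) y hy)
    exact key hx
  anti := fun n p p' hpp' => iSup₂_le fun q hq =>
    le_iSup₂_of_le (f := fun q (_ : p ≤ q) => X.bigr (q, n - q)) q (hpp'.trans hq) le_rfl

end ErMinimalAlgebra

/-- The condition that a morphism `f : M → A` from a bigraded `A_∞`-algebra to a filtered
dg-algebra satisfies
`f_s(M^{p_1,q_1} ⊗ ⋯ ⊗ M^{p_s,q_s}) ⊆ F^{∑p_i+(1-s)r} A^{∑p_i+∑q_i-s+1}` for all `s ≥ 1`. -/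
def IsErFiltered {k : Type*} [Field k] {A : Type*} [NonUnitalRing A] [Module k A]
    [IsScalarTower k A A] [SMulCommClass k A A] {X : FilteredDGAlgebra k A} {r : ℕ}
    {M : Type*} [AddCommGroup M] [Module k M] {N : ErMinimalAlgebra k r M}
    (φ : AInfAlgebra.Hom N.toAInfAlgebra X.toAInfAlgebra) : Prop :=
  ∀ (s : ℕ), 1 ≤ s → ∀ (p q : Fin s → ℤ) (a : Fin s → M), (∀ i, a i ∈ N.bigr (p i, q i)) →
    φ.f s a ∈ X.Fil (∑ i, p i + (1 - s) * r) (∑ i, p i + ∑ i, q i - s + 1)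

/-- The linear part `f_1`, as a morphism of filtered complexes. -/
def IsErFiltered.linearHom {k : Type*} [Field k] {A : Type*} [NonUnitalRing A] [Module k A]
    [IsScalarTower k A A] [SMulCommClass k A A] {X : FilteredDGAlgebra k A} {r : ℕ}
    {M : Type*} [AddCommGroup M] [Module k M] {N : ErMinimalAlgebra k r M}
    {φ : AInfAlgebra.Hom N.toAInfAlgebra X.toAInfAlgebra} (hφ : IsErFiltered φ) :
    FilteredComplex.Hom N.toFilteredComplex X.toFilteredComplex where
  f := φ.linearPart
  comm := φ.linearPart_d
  map_mem := fun p n x hx => by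
    have key : columnFiltration N.bigr p n ≤ (X.Fil p n).comap φ.linearPart := by
      refine iSup₂_le fun q hq y hy => ?_
      have h := hφ 1 le_rfl (fun _ => q) (fun _ => n - q) (fun _ => y) (fun _ => hy)
      have e1 : ∑ _i : Fin 1, q + (1 - ((1 : ℕ) : ℤ)) * r = q := by simp
      have e2 : ∑ _i : Fin 1, q + ∑ _i : Fin 1, (n - q) - ((1 : ℕ) : ℤ) + 1 = n := by simp
      rw [e1, e2] at h
      exact X.Fil_anti n hq h
    exact key hx

/-- An `E_r`-minimal `A_∞`-model, with underlying space `M`, of a filtered dg-algebra `X`: a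
bigraded `A_∞`-algebra with the bidegree conditions above and a morphism `f` of `A_∞`-algebras from
it to `X`, compatible with the filtration as above, such that `E_r(f_1) : E_r(M) → E_r(X)` is a
quasi-isomorphism of complexes. -/
structure ErMinimalModel {k : Type*} [Field k] {A : Type*} [NonUnitalRing A] [Module k A]
    [IsScalarTower k A A] [SMulCommClass k A A] (X : FilteredDGAlgebra k A) (r : ℕ)
    (M : Type*) [AddCommGroup M] [Module k M] extends ErMinimalAlgebra k r M where
  hom : AInfAlgebra.Hom toErMinimalAlgebra.toAInfAlgebra X.toAInfAlgebra
  hom_filtered : IsErFiltered (N := toErMinimalAlgebra) hom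
  quasiIso : hom_filtered.linearHom.IsPageQuasiIso r

/-!
The model is obtained by homotopy transfer along a contraction adapted to the filtration.

*The contraction.* Suppose that `d` raises the filtration by `c`, and let `C^p` be a complement in
`F^p` of the elements whose differential lies in `F^{p+c+1}`. Then `d` is injective on `C^p`, and
`C^p + d C^{p-c}` is a direct sum that meets `F^{p+1}` trivially. Hence there is a homotopy `h` with
`h d h = h` and `h h = 0`, lowering the filtration by `c`, whose image is the span of the `C^p`, and
on the complementary subcomplex `ker h ∩ ker (h d)` the differential raises the filtration by
`c + 1` (`GradedFiltration.exists_homotopy_step`). Doing this for `c = 0, …, r` splits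
`A = M ⊕ K` with `d` raising the filtration of `M` by `r + 1` and with a contracting homotopy `h` of
`K` lowering the filtration by `r` (`GradedFiltration.exists_homotopy`). The inclusion `i` and the
projection `p` are filtered, so `h` shows that `i` is a quasi-isomorphism on `E_r`
(`FilteredComplex.Hom.isPageQuasiIso_of_homotopy`). The bigrading of `M` is any splitting of the
induced filtration; boundedness and exhaustiveness are what makes it a direct sum decomposition
(`GradedFiltration.IsSplitting.isInternal`).

*The transfer.* A multilinear function on the words in the suspension of `M` with values in `A` is
an element of a convolution algebra. Let `τ = i + h (τ ⋆ τ)`, which determines `τ` recursively in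
the word length, and `β = d - p (τ ⋆ τ)`, with associated coderivation `b`. With
`Ω = d τ - τ b - τ ⋆ τ`, the side conditions give `h Ω = 0` and `p Ω = 0`, so `Ω = h d Ω`, and
the Bianchi identity
`d Ω = -Ω b - τ b b - (Ω ⋆ τ - τ ⋆ Ω)` together with `h τ = 0` turns this into
`Ω = -h (Ω ⋆ τ - τ ⋆ Ω)`. As `τ` vanishes on the empty word, `Ω = 0` by induction on the length
(`Contraction.curv_eq_zero`). Applying `p` to the Bianchi identity then gives `β b = 0`
(`Contraction.coder_bar`). These two equations are the identities of an `A_∞`-morphism to a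
dg-algebra and of an `A_∞`-algebra, up to the signs that come from the suspension
(`desuspend_graft`, `FilteredDGAlgebra.sum_composition`). In arity `s` the map `τ` involves `s - 1`
homotopies and `τ ⋆ τ` involves `s - 2`, which accounts for the filtration shifts `(1 - s) r` and
`(2 - s) r` (`Contraction.twist_mem`, `Contraction.quad_mem`).
-/

/-! ### Functions on words -/

section Words

variable {α : Type*} {W : Type*}

/-- The sum of `G x y` over all factorisations `w = x ++ y` of a word. -/
def splitSum [AddCommMonoid W] : List α → (List α → List α → W) → W
  | [], G => G [] []
  | a :: w, G => G [] (a :: w) + splitSum w fun x y => G (a :: x) y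

theorem splitSum_congr [AddCommMonoid W] {w : List α} {G G' : List α → List α → W}
    (h : ∀ x y, x ++ y = w → G x y = G' x y) : splitSum w G = splitSum w G' := by
  induction w generalizing G G' with
  | nil => exact h [] [] rfl
  | cons a w ih =>
    exact congrArg₂ (· + ·) (h _ _ rfl) (ih fun x y hxy => h _ _ (by simp [hxy]))

theorem splitSum_induction [AddCommMonoid W] {P : W → Prop} (hadd : ∀ u v, P u → P v → P (u + v))
    {w : List α} {G : List α → List α → W} (h : ∀ x y, x ++ y = w → P (G x y)) :
    P (splitSum w G) := by
  induction w generalizing G with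
  | nil => exact h [] [] rfl
  | cons a w ih =>
    exact hadd _ _ (h _ _ rfl) (ih fun x y hxy => h _ _ (by simp [hxy]))

theorem splitSum_zero [AddCommMonoid W] (w : List α) :
    splitSum w (fun _ _ => (0 : W)) = 0 := by
  induction w with
  | nil => rfl
  | cons a w ih => simp [splitSum, ih]

theorem splitSum_add [AddCommMonoid W] (w : List α) (G G' : List α → List α → W) :
    splitSum w (fun x y => G x y + G' x y) = splitSum w G + splitSum w G' := by
  induction w generalizing G G' with
  | nil => rfl
  | cons a w ih => simp only [splitSum, ih]; abel

theorem map_splitSum [AddCommMonoid W] {W' F : Type*} [AddCommMonoid W'] [FunLike F W W']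
    [AddMonoidHomClass F W W'] (g : F) (w : List α) (G : List α → List α → W) :
    g (splitSum w G) = splitSum w fun x y => g (G x y) := by
  induction w generalizing G with
  | nil => rfl
  | cons a w ih => simp only [splitSum, map_add, ih]

theorem splitSum_map [AddCommMonoid W] {γ : Type*} (f : γ → α) (w : List γ)
    (G : List α → List α → W) :
    splitSum (w.map f) G = splitSum w fun x y => G (x.map f) (y.map f) := by
  induction w generalizing G with
  | nil => rfl
  | cons a w ih => simp only [List.map_cons, splitSum, ih, List.map_nil]

theorem splitSum_of_right [AddCommMonoid W] (w : List α) (G : List α → List α → W)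
    (h : ∀ x a y, G x (a :: y) = 0) : splitSum w G = G w [] := by
  induction w generalizing G with
  | nil => rfl
  | cons a w ih => rw [splitSum, h, zero_add, ih _ fun x b y => h _ _ _]

theorem splitSum_assoc [AddCommMonoid W] (w : List α) (H : List α → List α → List α → W) :
    splitSum w (fun x v => splitSum v fun y z => H x y z) =
      splitSum w fun u z => splitSum u fun x y => H x y z := by
  induction w generalizing H with
  | nil => rfl
  | cons a w ih =>
    simp only [splitSum, ih, splitSum_add]
    abel

/-- The convolution product `(φ * ψ)(w) = ∑_{w = x ++ y} φ x * ψ y`. -/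
def conv [NonUnitalNonAssocSemiring W] (φ ψ : List α → W) (w : List α) : W :=
  splitSum w fun x y => φ x * ψ y

theorem conv_assoc [NonUnitalSemiring W] (φ ψ χ : List α → W) (w : List α) :
    conv (conv φ ψ) χ w = conv φ (conv ψ χ) w := by
  have hr : ∀ (c : W) (v : List α) (G : List α → List α → W),
      splitSum v G * c = splitSum v fun x y => G x y * c := fun c v G =>
    map_splitSum (AddMonoidHom.mulRight c) v G
  have hl : ∀ (c : W) (v : List α) (G : List α → List α → W),
      c * splitSum v G = splitSum v fun x y => c * G x y := fun c v G =>
    map_splitSum (AddMonoidHom.mulLeft c) v G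
  simp only [conv, hr, hl]
  rw [splitSum_assoc]
  simp only [mul_assoc]

variable {M : Type*}

/-- The transpose of the coderivation of the tensor coalgebra with corestriction `β`: it sends a
function `φ` on words to `w ↦ ∑ φ (σ x ++ [β y] ++ z)`, the sum being over all factorisations
`w = x ++ y ++ z` with `y` non-empty. The Koszul sign is carried by the operator `σ`, applied to
every letter of `x`. -/
def coder [AddCommMonoid W] (σ : M → M) (β : List M → M) : List M → (List M → W) → W
  | [], _ => 0
  | a :: w, φ =>
    splitSum w (fun y z => φ (β (a :: y) :: z)) + coder σ β w fun v => φ (σ a :: v)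

section

variable (σ : M → M) (β : List M → M)

theorem coder_zero [AddCommMonoid W] (w : List M) : coder σ β w (fun _ => (0 : W)) = 0 := by
  induction w with
  | nil => rfl
  | cons a w ih => simp [coder, ih, splitSum_zero]

theorem coder_add [AddCommMonoid W] (w : List M) (φ ψ : List M → W) :
    coder σ β w (fun v => φ v + ψ v) = coder σ β w φ + coder σ β w ψ := by
  induction w generalizing φ ψ with
  | nil => simp [coder]
  | cons a w ih => simp only [coder, ih, splitSum_add]; abel

theorem map_coder [AddCommMonoid W] {W' F : Type*} [AddCommMonoid W'] [FunLike F W W']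
    [AddMonoidHomClass F W W'] (g : F) (w : List M) (φ : List M → W) :
    g (coder σ β w φ) = coder σ β w fun v => g (φ v) := by
  induction w generalizing φ with
  | nil => exact map_zero g
  | cons a w ih => simp only [coder, map_add, ih, map_splitSum]

theorem coder_of_cons [AddCommMonoid W] (w : List M) (φ : List M → W)
    (h : ∀ a v, φ (a :: v) = 0) : coder σ β w φ = 0 := by
  induction w generalizing φ with
  | nil => rfl
  | cons a w ih =>
    rw [coder, ih (fun v => φ (σ a :: v)) fun b v => h _ _, add_zero]
    simp only [h, splitSum_zero]

/-- The coderivation property, in transposed form. -/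
theorem coder_conv [NonUnitalNonAssocSemiring W] (w : List M) (φ ψ : List M → W) :
    coder σ β w (conv φ ψ) =
      conv (fun x => coder σ β x φ) ψ w +
        conv (fun x => φ (x.map σ)) (fun y => coder σ β y ψ) w := by
  induction w generalizing φ with
  | nil => simp [coder, conv, splitSum]
  | cons a w ih =>
    have hr : ∀ (c : W) (v : List M) (G : List M → List M → W),
        splitSum v G * c = splitSum v fun x y => G x y * c := fun c v G =>
      map_splitSum (AddMonoidHom.mulRight c) v G
    have hl : ∀ (c : W) (v : List M) (G : List M → List M → W),
        c * splitSum v G = splitSum v fun x y => c * G x y := fun c v G =>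
      map_splitSum (AddMonoidHom.mulLeft c) v G
    have hc : ∀ c : W, coder σ β w (fun v => c * ψ (σ a :: v)) =
        c * coder σ β w fun v => ψ (σ a :: v) := fun c =>
      (map_coder σ β (AddMonoidHom.mulLeft c) w _).symm
    have e : ∀ b v, conv φ ψ (b :: v) = φ [] * ψ (b :: v) + conv (fun x => φ (b :: x)) ψ v :=
      fun b v => rfl
    have e1 : ∀ φ' ψ' : List M → W, conv φ' ψ' (a :: w) =
      φ' [] * ψ' (a :: w) + conv (fun x => φ' (a :: x)) ψ' w := fun φ' ψ' => rfl
    rw [coder]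
    simp only [e, coder_add, ih, hc, splitSum_add]
    rw [e1, e1]
    simp only [coder, zero_mul, zero_add, List.map_nil, List.map_cons]
    have e2 : ∀ φ' ψ' : List M → W, conv φ' ψ' = fun v => splitSum v fun x y => φ' x * ψ' y :=
      fun φ' ψ' => rfl
    simp only [e2, add_mul, hr, splitSum_add, mul_add, hl]
    rw [splitSum_assoc]
    abel

end

end Words

/-- A function on words that is linear in each letter. -/
def IsMultilinearOnWords (k : Type*) [Field k] {M W : Type*} [AddCommGroup M] [Module k M]
    [AddCommGroup W] [Module k W] (φ : List M → W) : Prop :=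
  ∀ x z, IsLinearMap k fun v => φ (x ++ v :: z)

namespace IsMultilinearOnWords

variable {k : Type*} [Field k] {M W W' : Type*} [AddCommGroup M] [Module k M]
    [AddCommGroup W] [Module k W] [AddCommGroup W'] [Module k W'] {φ ψ : List M → W}

theorem cons (h : IsMultilinearOnWords k φ) (a : M) :
    IsMultilinearOnWords k fun v => φ (a :: v) := fun x z => h (a :: x) z

theorem add (h : IsMultilinearOnWords k φ) (h' : IsMultilinearOnWords k ψ) :
    IsMultilinearOnWords k fun v => φ v + ψ v := fun x z =>
  ⟨fun u v => by dsimp only; rw [(h x z).map_add, (h' x z).map_add]; abel, fun c u => by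
    dsimp only; rw [(h x z).map_smul, (h' x z).map_smul, smul_add]⟩

theorem comp (g : W →ₗ[k] W') (h : IsMultilinearOnWords k φ) :
    IsMultilinearOnWords k fun v => g (φ v) := fun x z =>
  ⟨fun u v => by dsimp only; rw [(h x z).map_add, map_add],
    fun c u => by dsimp only; rw [(h x z).map_smul, map_smul]⟩

theorem map (s : M →ₗ[k] M) (h : IsMultilinearOnWords k φ) :
    IsMultilinearOnWords k fun v => φ (v.map s) := fun x z =>
  ⟨fun u v => by simpa using (h (x.map s) (z.map s)).map_add (s u) (s v),
    fun c u => by simpa using (h (x.map s) (z.map s)).map_smul c (s u)⟩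

theorem conv {A : Type*} [NonUnitalRing A] [Module k A] [IsScalarTower k A A]
    [SMulCommClass k A A] {φ ψ : List M → A} (h : IsMultilinearOnWords k φ)
    (h' : IsMultilinearOnWords k ψ) : IsMultilinearOnWords k (conv φ ψ) := by
  intro x z
  induction x generalizing φ with
  | nil =>
    have e : ∀ v, _root_.conv φ ψ ([] ++ v :: z) =
        φ [] * ψ (v :: z) + splitSum z fun x y => φ (v :: x) * ψ y := fun v => rfl
    refine ⟨fun u v => ?_, fun c u => ?_⟩
    · have h1 := fun y => (h [] y).map_add u v
      have h2 := (h' [] z).map_add u v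
      simp only [List.nil_append] at h1 h2
      simp only [e, h1, h2, mul_add, add_mul, splitSum_add]
      abel
    · have h1 := fun y => (h [] y).map_smul c u
      have h2 := (h' [] z).map_smul c u
      simp only [List.nil_append] at h1 h2
      simp only [e, h1, h2, smul_mul_assoc, mul_smul_comm, smul_add]
      exact congrArg _ (map_splitSum (DistribSMul.toAddMonoidHom A c) z _).symm
  | cons a x ih =>
    have e : ∀ v, _root_.conv φ ψ (a :: x ++ v :: z) =
        φ [] * ψ (a :: x ++ v :: z) + _root_.conv (fun x => φ (a :: x)) ψ (x ++ v :: z) :=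
      fun v => rfl
    have ih := ih (h.cons a)
    refine ⟨fun u v => ?_, fun c u => ?_⟩
    · simp only [e, (h' (a :: x) z).map_add, ih.map_add, mul_add]
      abel
    · simp only [e, (h' (a :: x) z).map_smul, ih.map_smul, mul_smul_comm, smul_add]

theorem map_neg (h : IsMultilinearOnWords k φ) (x z : List M) (u : M) :
    φ (x ++ (-u) :: z) = -φ (x ++ u :: z) := (h x z).map_neg u

/-- A multilinear function on words restricts to a multilinear map on the words of length `n`. -/
def toMultilinearMap (h : IsMultilinearOnWords k φ) (n : ℕ) :
    MultilinearMap k (fun _ : Fin n => M) W :=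
  have key : ∀ {inst : DecidableEq (Fin n)} (v : Fin n → M) (i : Fin n) (u : M),
      List.ofFn (Function.update v i u) =
        (List.ofFn v).take i ++ u :: (List.ofFn v).drop (i + 1) := by
    intro inst v i u
    have hi : (i : ℕ) < (List.ofFn v).length := by simp
    rw [← (List.set_eq_take_append_cons_drop (a := u)).trans (if_pos hi)]
    refine List.ext_getElem (by simp) fun j h1 h2 => ?_
    rw [List.getElem_ofFn, List.getElem_set, Function.update_apply]
    simp [Fin.ext_iff, eq_comm]
  { toFun := fun v => φ (List.ofFn v)
    map_update_add' := fun v i u u' => by simp only [key, (h _ _).map_add]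
    map_update_smul' := fun v i c u => by simp only [key, (h _ _).map_smul] }

end IsMultilinearOnWords

/-! ### The transferred structure in bar form -/

/-- A contraction of a dg-algebra `A` onto a complex `M`, i.e. maps `i : M → A`, `p : A → M` and a
homotopy `h` with `d h + h d + i p = 1`, satisfying all side conditions. The gradings enter only
through the operators `κ` and `κM`, which multiply an element of degree `n` by `(-1)^n`. -/
structure Contraction (k A M : Type*) [Field k] [NonUnitalRing A] [Module k A] [AddCommGroup M]
    [Module k M] where
  d : A →ₗ[k] A
  h : A →ₗ[k] A
  κ : A →ₗ[k] A
  i : M →ₗ[k] A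
  p : A →ₗ[k] M
  dM : M →ₗ[k] M
  κM : M →ₗ[k] M
  d_d : ∀ x, d (d x) = 0
  homotopy : ∀ x, d (h x) + h (d x) + i (p x) = x
  h_i : ∀ x, h (i x) = 0
  p_h : ∀ x, p (h x) = 0
  h_h : ∀ x, h (h x) = 0
  p_i : ∀ x, p (i x) = x
  d_i : ∀ x, d (i x) = i (dM x)
  leibniz : ∀ x y, d (x * y) = d x * y + κ x * d y
  κ_mul : ∀ x y, κ (x * y) = κ x * κ y
  κ_κ : ∀ x, κ (κ x) = x
  d_κ : ∀ x, d (κ x) = -κ (d x)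
  h_κ : ∀ x, h (κ x) = -κ (h x)
  i_κ : ∀ x, i (κM x) = κ (i x)

/-- The projection of words onto the words of length one. -/
def letter {M : Type*} [Zero M] : List M → M
  | [a] => a
  | _ => 0

namespace Contraction

variable {k A M : Type*} [Field k] [NonUnitalRing A] [Module k A] [AddCommGroup M]
    [Module k M] (C : Contraction k A M)

theorem p_d (x : A) : C.p (C.d x) = C.dM (C.p x) := by
  have h1 := C.homotopy (C.d x)
  have h2 := congrArg C.d (C.homotopy x)
  simp only [C.d_d, map_add, map_zero, add_zero, zero_add, C.d_i] at h1 h2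
  have h3 := add_left_cancel (h1.trans h2.symm)
  simpa only [C.p_i] using congrArg C.p h3

theorem p_κ (x : A) : C.p (C.κ x) = C.κM (C.p x) := by
  have h1 := C.homotopy (C.κ x)
  have h2 := congrArg C.κ (C.homotopy x)
  simp only [C.h_κ, C.d_κ, map_neg, neg_neg, map_add, ← C.i_κ] at h1 h2
  have h3 := add_left_cancel (h1.trans h2.symm)
  simpa only [C.p_i] using congrArg C.p h3

theorem κM_κM (x : M) : C.κM (C.κM x) = x := by
  have := congrArg C.p (C.κ_κ (C.i x))
  simpa only [p_κ, C.p_i] using this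

theorem dM_κM (x : M) : C.dM (C.κM x) = -C.κM (C.dM x) := by
  have := congrArg C.p (C.d_κ (C.i x))
  simpa only [← C.i_κ, C.d_i, map_neg, C.p_i] using this

/-- The parity operator of the suspension of `M`, whose degrees are those of `M` minus one. -/
def σ : M →ₗ[k] M := -C.κM

theorem σ_σ (x : M) : C.σ (C.σ x) = x := by simp [σ, C.κM_κM]

theorem map_σ_map_σ (w : List M) : (w.map C.σ).map C.σ = w := by
  simp [List.map_map, Function.comp_def, C.σ_σ]

/-- The successive approximations of `twist`: the `n`-th one is correct on words shorter
than `n`. -/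
def approx : ℕ → List M → A
  | 0, _ => 0
  | n + 1, w =>
    C.i (letter w) + C.h (conv (fun x => approx n (x.map C.σ)) (approx n) w)

/-- The twisting cochain `τ` of the transferred structure: the solution of
`τ = i + h (τ ⋆ τ)`, where `τ ⋆ τ` is the signed convolution square. -/
def twist (w : List M) : A := C.approx (w.length + 1) w

/-- The signed convolution square `τ ⋆ τ` of the twisting cochain. -/
def quad (w : List M) : A := conv (fun x => C.twist (x.map C.σ)) C.twist w

/-- The corestriction `β = d - p (τ ⋆ τ)` of the transferred coderivation. -/
def bar (w : List M) : M := C.dM (letter w) - C.p (C.quad w)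

theorem approx_nil (n : ℕ) : C.approx n [] = 0 := by
  induction n with
  | zero => rfl
  | succ n ih => simp [approx, letter, conv, splitSum, ih]

theorem approx_succ (n : ℕ) (w : List M) (hw : w.length ≤ n) :
    C.approx (n + 1) w = C.approx n w := by
  induction n generalizing w with
  | zero =>
    obtain rfl : w = [] := List.length_eq_zero_iff.1 (by omega)
    simp [approx_nil]
  | succ n ih =>
    rw [approx]
    conv_rhs => rw [approx]
    congr 2
    refine splitSum_congr fun x y hxy => ?_
    subst hxy
    rw [List.length_append] at hw
    rcases x with _ | ⟨a, x⟩
    · simp [approx_nil]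
    rcases y with _ | ⟨b, y⟩
    · simp [approx_nil]
    simp only [List.length_cons] at hw
    dsimp only
    rw [ih (b :: y) (by simp only [List.length_cons]; omega),
      ih ((a :: x).map C.σ) (by simp only [List.length_map, List.length_cons]; omega)]

theorem approx_eq_twist (n : ℕ) (w : List M) (hw : w.length < n) :
    C.approx n w = C.twist w := by
  obtain ⟨m, rfl⟩ := Nat.exists_eq_add_of_lt hw
  clear hw
  induction m with
  | zero => rfl
  | succ m ih => exact (C.approx_succ (w.length + m + 1) w (by omega)).trans ih

theorem twist_eq (w : List M) : C.twist w = C.i (letter w) + C.h (C.quad w) := by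
  rw [← C.approx_eq_twist (w.length + 2) w (by omega), approx]
  congr 2
  refine splitSum_congr fun x y hxy => ?_
  subst hxy
  dsimp only
  rw [approx_eq_twist _ _ _ (by simp), approx_eq_twist _ _ _ (by simp)]

theorem twist_nil : C.twist [] = 0 := C.approx_nil _

theorem p_twist (w : List M) : C.p (C.twist w) = letter w := by
  rw [twist_eq, map_add, C.p_i, C.p_h, add_zero]

theorem h_twist (w : List M) : C.h (C.twist w) = 0 := by
  rw [twist_eq, map_add, C.h_i, C.h_h, add_zero]

theorem letter_map_σ (w : List M) : letter (w.map C.σ) = -C.κM (letter w) := by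
  rcases w with _ | ⟨a, _ | ⟨b, w⟩⟩ <;> simp [letter, σ]

/-- The twisting cochain has degree one. -/
theorem twist_map_σ (w : List M) : C.twist (w.map C.σ) = -C.κ (C.twist w) := by
  have key : ∀ n w, C.approx n (w.map C.σ) = -C.κ (C.approx n w) := by
    intro n
    induction n with
    | zero => simp [approx]
    | succ n ih =>
      intro w
      rw [approx, approx, letter_map_σ, conv, splitSum_map]
      have e : (splitSum w fun x y => C.approx n (List.map C.σ (List.map C.σ x)) *
          C.approx n (List.map C.σ y)) =
          C.κ (conv (fun x => C.approx n (x.map C.σ)) (C.approx n) w) := by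
        rw [conv, map_splitSum]
        simp only [ih, C.κ_mul, map_neg, neg_neg, mul_neg, neg_mul]
      rw [e, C.h_κ, map_neg, C.i_κ, map_add, neg_add]
  rw [twist, List.length_map, key, ← twist]

theorem quad_map_σ (w : List M) : C.quad (w.map C.σ) = C.κ (C.quad w) := by
  rw [quad, quad, conv, conv, splitSum_map, map_splitSum]
  simp only [twist_map_σ, C.κ_mul, map_neg, neg_neg, mul_neg, neg_mul]

theorem bar_map_σ (w : List M) : C.bar (w.map C.σ) = -C.σ (C.bar w) := by
  have e : ∀ x, C.σ x = -C.κM x := fun x => rfl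
  rw [bar, bar, quad_map_σ, letter_map_σ, map_neg, dM_κM, p_κ, e, map_sub]
  abel

theorem isMultilinear_letter : IsMultilinearOnWords k (letter : List M → M) := by
  intro x z
  rcases x with _ | ⟨a, x⟩
  · rcases z with _ | ⟨b, z⟩
    · exact ⟨fun _ _ => rfl, fun _ _ => rfl⟩
    · exact ⟨fun _ _ => (add_zero (0 : M)).symm, fun c _ => (smul_zero c).symm⟩
  · have e : ∀ u, letter (a :: x ++ u :: z) = 0 := fun u => by
      rcases x with _ | ⟨b, x⟩ <;> rfl
    simp only [e]
    exact ⟨fun _ _ => (add_zero (0 : M)).symm, fun c _ => (smul_zero c).symm⟩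

theorem coder_map_σ {W : Type*} [AddCommGroup W] [Module k W] {φ : List M → W}
    (hφ : IsMultilinearOnWords k φ) (w : List M) :
    coder C.σ C.bar (w.map C.σ) φ = -coder C.σ C.bar w fun v => φ (v.map C.σ) := by
  induction w generalizing φ with
  | nil => simp [coder]
  | cons a w ih =>
    rw [List.map_cons, coder, coder, ih (hφ.cons _), splitSum_map, neg_add,
      ← negAddMonoidHom_apply (splitSum w _), map_splitSum]
    congr 1
    refine splitSum_congr fun y z _ => ?_
    rw [negAddMonoidHom_apply, List.map_cons, ← List.map_cons, bar_map_σ]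
    exact hφ.map_neg [] _ _

/-- The curvature `d τ - τ b - τ ⋆ τ` of the twisting cochain. -/
def curv (w : List M) : A := C.d (C.twist w) - coder C.σ C.bar w C.twist - C.quad w

theorem coder_letter (w : List M) : coder C.σ C.bar w letter = C.bar w := by
  rcases w with _ | ⟨a, w⟩
  · simp [coder, bar, letter, quad, conv, splitSum, twist_nil]
  · rw [coder, coder_of_cons, add_zero, splitSum_of_right]
    · rfl
    · intro x a y
      rfl
    · intro a v
      rfl

theorem p_curv (w : List M) : C.p (C.curv w) = 0 := by
  rw [curv, map_sub, map_sub, C.p_d, p_twist, map_coder]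
  simp only [p_twist]
  rw [coder_letter, bar]
  abel

theorem h_curv (w : List M) : C.h (C.curv w) = 0 := by
  have e : C.h (C.d (C.h (C.quad w))) = C.h (C.quad w) := by
    have := C.homotopy (C.h (C.quad w))
    rwa [C.h_h, C.p_h, map_zero, map_zero, zero_add, add_zero] at this
  rw [curv, map_sub, map_sub, map_coder]
  simp only [h_twist]
  rw [coder_zero, twist_eq, map_add, map_add, e, C.d_i, C.h_i]
  abel

section Multilinear

variable [IsScalarTower k A A] [SMulCommClass k A A]

theorem isMultilinear_twist : IsMultilinearOnWords k C.twist := by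
  have key : ∀ n, IsMultilinearOnWords k (C.approx n) := by
    intro n
    induction n with
    | zero => exact fun x z => ⟨fun _ _ => (add_zero (0 : A)).symm, fun c _ => (smul_zero c).symm⟩
    | succ n ih =>
      exact (isMultilinear_letter.comp C.i).add (((ih.map C.σ).conv ih).comp C.h)
  intro x z
  have e : ∀ u, C.twist (x ++ u :: z) = C.approx (x.length + z.length + 2) (x ++ u :: z) :=
    fun u => (C.approx_eq_twist _ _ (by simp; omega)).symm
  simp only [e]
  exact key _ x z

theorem isMultilinear_bar : IsMultilinearOnWords k C.bar := by
  have h := (isMultilinear_letter.comp C.dM).add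
    (((C.isMultilinear_twist.map C.σ).conv C.isMultilinear_twist).comp (-C.p))
  refine (funext fun w => ?_ : C.bar = _) ▸ h
  rw [bar, sub_eq_add_neg]
  rfl

/-- The Bianchi identity for the curvature. -/
theorem d_curv (w : List M) :
    C.d (C.curv w) = -coder C.σ C.bar w C.curv
      - coder C.σ C.bar w (fun v => coder C.σ C.bar v C.twist)
      - (conv (fun x => C.curv (x.map C.σ)) C.twist w - conv C.twist C.curv w) := by
  set b : List M → (List M → A) → A := fun v φ => coder C.σ C.bar v φ with hb
  have hdt : ∀ v, C.d (C.twist v) = C.curv v + b v C.twist + C.quad v := fun v => by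
    simp only [curv, hb]; abel
  have hq : C.d (C.quad w) = conv (fun x => C.d (C.twist (x.map C.σ))) C.twist w
      - conv C.twist (fun y => C.d (C.twist y)) w := by
    rw [quad, conv, map_splitSum, conv, conv, sub_eq_add_neg, ← negAddMonoidHom_apply,
      map_splitSum, ← splitSum_add]
    refine splitSum_congr fun x y _ => ?_
    rw [C.leibniz, twist_map_σ, map_neg C.κ, C.κ_κ, neg_mul, negAddMonoidHom_apply]
  have hqb : b w C.quad =
      -conv (fun x => b (x.map C.σ) C.twist) C.twist w + conv C.twist (fun y => b y C.twist) w := by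
    have := coder_conv C.σ C.bar w (fun x => C.twist (x.map C.σ)) C.twist
    simp only [map_σ_map_σ] at this
    refine this.trans ?_
    congr 1
    rw [conv, conv, ← negAddMonoidHom_apply, map_splitSum]
    refine splitSum_congr fun x y _ => ?_
    rw [negAddMonoidHom_apply, hb]
    simp only [C.coder_map_σ C.isMultilinear_twist, neg_mul, neg_neg]
  have hass : conv (fun x => C.quad (x.map C.σ)) C.twist w = conv C.twist C.quad w := by
    have e : (fun x => C.quad (x.map C.σ)) = conv C.twist fun x => C.twist (x.map C.σ) := by
      funext x
      rw [quad, conv, splitSum_map]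
      simp only [map_σ_map_σ]
      rfl
    rw [e, conv_assoc]
    rfl
  have hadd : ∀ φ ψ ψ' : List M → A,
      conv φ (fun y => ψ y + ψ' y) w = conv φ ψ w + conv φ ψ' w := fun φ ψ ψ' => by
    simp only [conv, mul_add, splitSum_add]
  have hadd' : ∀ φ φ' ψ : List M → A,
      conv (fun x => φ x + φ' x) ψ w = conv φ ψ w + conv φ' ψ w := fun φ ψ ψ' => by
    simp only [conv, add_mul, splitSum_add]
  have hdb : C.d (b w C.twist) = b w C.curv + b w (fun v => b v C.twist) + b w C.quad := by
    simp only [hb]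
    rw [map_coder, ← coder_add, ← coder_add]
    simp only [hdt]
    rfl
  have e : C.d (C.curv w) = -C.d (b w C.twist) - C.d (C.quad w) := by
    rw [curv, map_sub, map_sub, C.d_d, zero_sub]
  rw [e, hdb, hq]
  simp only [hdt, hadd, hadd', hass, hqb]
  abel

/-- The twisting cochain is flat: applying `h` to the Bianchi identity gives
`Ω = -h (Ω ⋆ τ - τ ⋆ Ω)`, and `τ` vanishes on the empty word. -/
theorem curv_eq_zero (w : List M) : C.curv w = 0 := by
  induction hn : w.length using Nat.strong_induction_on generalizing w with
  | _ n ih =>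
    have e := C.homotopy (C.curv w)
    rw [h_curv, p_curv, map_zero, map_zero, zero_add, add_zero, d_curv, map_sub, map_sub, map_neg,
      map_coder, map_coder] at e
    simp only [h_curv, map_coder, h_twist, coder_zero, neg_zero, sub_zero, zero_sub] at e
    have h1 : conv (fun x => C.curv (x.map C.σ)) C.twist w = 0 := by
      rw [← splitSum_zero w]
      refine splitSum_congr fun x y hxy => ?_
      subst hxy
      rcases y with _ | ⟨b, y⟩
      · rw [twist_nil, mul_zero]
      · dsimp only
        rw [ih x.length (by simp [← hn]) (x.map C.σ) (by simp), zero_mul]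
    have h2 : conv C.twist C.curv w = 0 := by
      rw [← splitSum_zero w]
      refine splitSum_congr fun x y hxy => ?_
      subst hxy
      rcases x with _ | ⟨b, x⟩
      · rw [twist_nil, zero_mul]
      · rw [ih y.length (by simp [← hn]) y rfl, mul_zero]
    rw [← e, h1, h2, sub_zero, map_zero, neg_zero]

/-- The `A_∞`-morphism identities in bar form. -/
theorem coder_twist (w : List M) :
    coder C.σ C.bar w C.twist = C.d (C.twist w) - C.quad w := by
  have := C.curv_eq_zero w
  rw [curv, sub_right_comm, sub_eq_zero] at this
  exact this.symm

/-- The `A_∞`-identities in bar form. -/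
theorem coder_bar (w : List M) : coder C.σ C.bar w C.bar = 0 := by
  have h := C.d_curv w
  have e : (C.curv : List M → A) = fun _ => 0 := funext C.curv_eq_zero
  have h1 : ∀ φ : List M → A, conv (fun _ => (0 : A)) φ w = 0 := fun φ => by
    simp only [conv, zero_mul, splitSum_zero]
  have h2 : ∀ φ : List M → A, conv φ (fun _ => (0 : A)) w = 0 := fun φ => by
    simp only [conv, mul_zero, splitSum_zero]
  rw [e] at h
  simp only [h1, h2, map_zero, coder_zero, neg_zero, sub_zero, zero_sub] at h
  have h3 := congrArg C.p (neg_eq_zero.1 h.symm)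
  rw [map_zero, map_coder] at h3
  simpa only [map_coder, p_twist, coder_letter] using h3

end Multilinear

end Contraction

/-! ### Koszul signs -/

/-- The sign `(-1)^n` in the field `k`. -/
def koszulSign (k : Type*) [Field k] (n : ℤ) : k := ((n.negOnePow : ℤ) : k)

section KoszulSign

variable {k : Type*} [Field k] {V : Type*} [AddCommGroup V] [Module k V]

theorem negOnePow_smul_eq (n : ℤ) (x : V) : n.negOnePow • x = koszulSign k n • x := by
  rw [koszulSign, Units.smul_def, Int.cast_smul_eq_zsmul]

theorem koszulSign_add (m n : ℤ) : koszulSign k (m + n) = koszulSign k m * koszulSign k n := by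
  simp [koszulSign, Int.negOnePow_add]

theorem koszulSign_zero : koszulSign k 0 = 1 := by simp [koszulSign]

theorem koszulSign_one : koszulSign k 1 = -1 := by simp [koszulSign]

theorem koszulSign_congr {m n : ℤ} (c : ℤ) (h : m - n = 2 * c) :
    koszulSign k m = koszulSign k n := by
  rw [koszulSign, koszulSign, (Int.negOnePow_eq_iff m n).2 ⟨c, by omega⟩]

theorem koszulSign_mul_self (n : ℤ) : koszulSign k n * koszulSign k n = 1 := by
  rw [← koszulSign_add, koszulSign_congr n (n := 0) (by ring), koszulSign_zero]

theorem koszulSign_sum {ι : Type*} (s : Finset ι) (f : ι → ℤ) :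
    koszulSign k (∑ i ∈ s, f i) = ∏ i ∈ s, koszulSign k (f i) := by
  classical
  induction s using Finset.induction_on with
  | empty => simp [koszulSign_zero]
  | insert a s ha ih => rw [Finset.sum_insert ha, Finset.prod_insert ha, koszulSign_add, ih]

end KoszulSign

/-! ### Words cut out of a sequence -/

/-- The word `a j, a (j + 1), …, a (j + n - 1)`. -/
def subword {M : Type*} (a : ℕ → M) (j n : ℕ) : List M := List.ofFn fun i : Fin n => a (j + i)

section Subword

variable {M W : Type*}

theorem subword_zero (a : ℕ → M) (j : ℕ) : subword a j 0 = [] := rfl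

theorem subword_succ (a : ℕ → M) (j n : ℕ) :
    subword a j (n + 1) = a j :: subword a (j + 1) n := by
  simp [subword, List.ofFn_succ, add_assoc, add_comm 1]

theorem subword_comp_add (a : ℕ → M) (j i n : ℕ) :
    subword (fun u => a (j + u)) i n = subword a (j + i) n := by
  simp [subword, add_assoc]

theorem subword_congr {a b : ℕ → M} (i j n : ℕ) (h : ∀ u < n, a (i + u) = b (j + u)) :
    subword a i n = subword b j n :=
  congrArg List.ofFn (funext fun u => h u u.2)

theorem subword_add (a : ℕ → M) (j m n : ℕ) :
    subword a j (m + n) = subword a j m ++ subword a (j + m) n := by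
  induction m generalizing j with
  | zero => simp [subword_zero]
  | succ m ih =>
    rw [add_right_comm, subword_succ, ih, subword_succ, List.cons_append, add_right_comm j 1 m,
      add_assoc j m 1]

theorem subword_graft (a : ℕ → M) (r s t : ℕ) (hs : 1 ≤ s) (x : M) :
    subword (graft a r s x) 0 (r + 1 + t) =
      subword a 0 r ++ x :: subword a (r + s) t := by
  rw [add_assoc, subword_add, add_comm 1 t, subword_succ]
  congr 1
  · exact subword_congr _ _ _ fun u hu => by simp [graft, hu]
  · congr 1
    · simp [graft]
    · refine subword_congr _ _ _ fun u _ => ?_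
      rw [graft, if_neg (by omega), if_neg (by omega)]
      congr 1
      omega

theorem splitSum_subword [AddCommMonoid W] (a : ℕ → M) (j n : ℕ) (G : List M → List M → W) :
    splitSum (subword a j n) G =
      ∑ i ∈ Finset.range (n + 1), G (subword a j i) (subword a (j + i) (n - i)) := by
  induction n generalizing j G with
  | zero => simp [subword_zero, splitSum]
  | succ n ih =>
    rw [subword_succ, splitSum, ih, Finset.sum_range_succ' _ (n + 1), add_comm, ← subword_succ]
    congr 1
    refine Finset.sum_congr rfl fun i _ => ?_
    rw [subword_succ, Nat.add_sub_add_right, add_right_comm, add_assoc j i 1]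

theorem coder_subword [AddCommMonoid W] (σ : M → M) (β : List M → M) (a : ℕ → M) (j n : ℕ)
    (φ : List M → W) :
    coder σ β (subword a j n) φ =
      ∑ r ∈ Finset.range n, ∑ s ∈ Finset.Icc 1 (n - r),
        φ ((subword a j r).map σ ++ β (subword a (j + r) s) ::
          subword a (j + r + s) (n - r - s)) := by
  induction n generalizing j φ with
  | zero => simp [subword_zero, coder]
  | succ n ih =>
    rw [subword_succ, coder, ih, splitSum_subword]
    refine Eq.trans ?_ (Finset.sum_range_succ' _ n).symm
    refine (add_comm _ _).trans (congrArg₂ (· + ·) ?_ ?_)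
    · refine Finset.sum_congr rfl fun r _ => ?_
      rw [Nat.add_sub_add_right]
      refine Finset.sum_congr rfl fun s _ => ?_
      rw [subword_succ, List.map_cons, List.cons_append, add_right_comm j 1 r, add_assoc j r 1]
    · have e : Finset.Icc 1 (n + 1 - 0) = (Finset.range (n + 1)).image (· + 1) := by
        ext u
        simp only [Finset.mem_Icc, Finset.mem_image, Finset.mem_range]
        exact ⟨fun h => ⟨u - 1, by omega, by omega⟩, by rintro ⟨v, hv, rfl⟩; omega⟩
      rw [e, Finset.sum_image (by simp)]
      refine Finset.sum_congr rfl fun s _ => ?_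
      rw [subword_zero, List.map_nil, List.nil_append, ← subword_succ, Nat.sub_zero,
        Nat.add_sub_add_right, add_zero, add_right_comm, add_assoc j s 1]

end Subword

/-! ### Desuspension -/

section Desuspension

variable {k : Type*} [Field k] {M W : Type*} [AddCommGroup M] [Module k M]
    [AddCommGroup W] [Module k W]

/-- The multilinear map of arity `n` on `M` corresponding to a multilinear function `φ` on words
in the suspension of `M`; on homogeneous elements it is
`(-1)^{(n-1) deg a_0 + (n-2) deg a_1 + ⋯ + deg a_{n-2}} φ(a_0, …, a_{n-1})`. -/
def desuspend {φ : List M → W} (hφ : IsMultilinearOnWords k φ) (κ : M →ₗ[k] M) (n : ℕ) :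
    MultilinearMap k (fun _ : Fin n => M) W :=
  (hφ.toMultilinearMap n).compLinearMap fun i => κ ^ (n - 1 - (i : ℕ))

variable {κ : M →ₗ[k] M} {gr : ℤ → Submodule k M}
    (hκ : ∀ n, ∀ x ∈ gr n, κ x = koszulSign k n • x)
include hκ

theorem parity_pow (j : ℕ) (n : ℤ) (x : M) (hx : x ∈ gr n) :
    (κ ^ j) x = koszulSign k (j * n) • x := by
  induction j with
  | zero => simp [koszulSign_zero]
  | succ j ih =>
    rw [pow_succ', Module.End.mul_apply, ih, map_smul, hκ n x hx, smul_smul, ← koszulSign_add]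
    congr 2
    push_cast
    ring

theorem desuspend_subword {φ : List M → W} (hφ : IsMultilinearOnWords k φ) (n : ℕ) (a : ℕ → M)
    (deg : ℕ → ℤ) (ha : ∀ i < n, a i ∈ gr (deg i)) :
    desuspend hφ κ n (fun i => a i) =
      koszulSign k (∑ i ∈ Finset.range n, ((n : ℤ) - 1 - i) * deg i) • φ (subword a 0 n) := by
  have e : (fun i : Fin n => (κ ^ (n - 1 - (i : ℕ))) (a i)) =
      fun i : Fin n => koszulSign k (((n : ℤ) - 1 - i) * deg i) • a i := by
    funext i
    have hi := i.2
    rw [parity_pow hκ _ _ _ (ha i i.2)]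
    congr 3
    omega
  rw [desuspend, MultilinearMap.compLinearMap_apply, e, MultilinearMap.map_smul_univ,
    ← koszulSign_sum, Fin.sum_univ_eq_sum_range fun i => ((n : ℤ) - 1 - i) * deg i]
  congr 1
  change φ (List.ofFn fun i : Fin n => a i) = _
  simp [subword]

theorem map_suspended_subword {φ : List M → W} (hφ : IsMultilinearOnWords k φ) (a : ℕ → M)
    (deg : ℕ → ℤ) (ha : ∀ i, a i ∈ gr (deg i)) (j n : ℕ) (z : List M) :
    φ ((subword a j n).map (-κ) ++ z) =
      koszulSign k (∑ i ∈ Finset.range n, (deg (j + i) - 1)) • φ (subword a j n ++ z) := by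
  induction n generalizing j φ with
  | zero => simp [subword_zero, koszulSign_zero]
  | succ n ih =>
    rw [subword_succ, List.map_cons, List.cons_append, List.cons_append, Finset.sum_range_succ',
      koszulSign_add, ih (hφ.cons _) (j + 1)]
    have e : (-κ) (a j) = koszulSign k (deg j - 1) • a j := by
      rw [LinearMap.neg_apply, hκ _ _ (ha j), ← neg_smul]
      congr 1
      rw [sub_eq_add_neg, koszulSign_add, koszulSign_congr (-1) (m := -1) (n := 1) rfl,
        koszulSign_one, mul_neg_one]
    have e' := (hφ [] (subword a (j + 1) n ++ z)).map_smul (koszulSign k (deg j - 1)) (a j)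
    simp only [List.nil_append] at e'
    rw [e, e', smul_smul]
    congr 3
    refine Finset.sum_congr rfl fun i _ => ?_
    rw [add_right_comm, add_assoc]

/-- The signs of the `A_∞`-identities are Koszul signs in the suspension. -/
theorem desuspend_graft {φ : List M → W} (hφ : IsMultilinearOnWords k φ) {β : List M → M}
    (hβ : IsMultilinearOnWords k β) (a : ℕ → M) (deg : ℕ → ℤ) (ha : ∀ i, a i ∈ gr (deg i))
    (r s t N : ℕ) (hN : N = r + 1 + t) (hs : 1 ≤ s)
    (hmem : β (subword a r s) ∈ gr (∑ j ∈ Finset.range s, deg (r + j) + 2 - s)) :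
    ((r : ℤ) + s * t + s * ∑ i ∈ Finset.range r, deg i).negOnePow •
        desuspend hφ κ N
          (fun i => graft a r s (desuspend hβ κ s fun j => a (r + j)) i) =
      koszulSign k (∑ i ∈ Finset.range (r + s + t), ((r + s + t : ℕ) - 1 - i : ℤ) * deg i) •
        φ ((subword a 0 r).map (-κ) ++ β (subword a r s) :: subword a (r + s) t) := by
  subst hN
  set D := ∑ j ∈ Finset.range s, deg (r + j) + 2 - s with hD
  have hin := desuspend_subword hκ hβ s (fun j => a (r + j)) (fun j => deg (r + j))
    fun j _ => ha _
  rw [subword_comp_add, add_zero] at hin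
  set x := desuspend hβ κ s fun j => a (r + j) with hx
  have hxm : x ∈ gr D := hin ▸ Submodule.smul_mem _ _ hmem
  have hout := desuspend_subword hκ hφ (r + 1 + t) (graft a r s x) (graft deg r s D) fun i _ => by
    simp only [graft]
    split_ifs
    exacts [ha _, hxm, ha _]
  rw [hout, subword_graft _ _ _ _ hs, hin, (hφ _ _).map_smul, map_suspended_subword hκ hφ a deg ha,
    negOnePow_smul_eq (k := k), smul_smul, smul_smul, smul_smul, ← koszulSign_add, ← koszulSign_add,
    ← koszulSign_add]
  congr 1
  have e1 : ∑ i ∈ Finset.range (r + 1 + t), (((r + 1 + t : ℕ) : ℤ) - 1 - i) * graft deg r s D i =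
      ∑ i ∈ Finset.range r, ((r : ℤ) + t - i) * deg i + t * D +
        ∑ u ∈ Finset.range t, ((t : ℤ) - 1 - u) * deg (r + s + u) := by
    rw [Finset.sum_range_add, Finset.sum_range_succ]
    congr 2
    · refine Finset.sum_congr rfl fun i hi => ?_
      rw [Finset.mem_range] at hi
      rw [graft, if_pos hi]
      push_cast
      ring
    · rw [graft, if_neg (lt_irrefl _), if_pos rfl]
      push_cast
      ring
    · funext u
      rw [graft, if_neg (by omega), if_neg (by omega),
        show r + 1 + u + s - 1 = r + s + u by omega]
      push_cast
      ring
  have e2 : ∑ i ∈ Finset.range (r + s + t), (((r + s + t : ℕ) : ℤ) - 1 - i) * deg i =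
      (∑ i ∈ Finset.range r, ((r : ℤ) + t - i) * deg i +
          (s - 1) * ∑ i ∈ Finset.range r, deg i) +
        (∑ j ∈ Finset.range s, ((s : ℤ) - 1 - j) * deg (r + j) +
          t * ∑ j ∈ Finset.range s, deg (r + j)) +
        ∑ u ∈ Finset.range t, ((t : ℤ) - 1 - u) * deg (r + s + u) := by
    rw [Finset.sum_range_add, Finset.sum_range_add, Finset.mul_sum, Finset.mul_sum,
      ← Finset.sum_add_distrib, ← Finset.sum_add_distrib]
    congr 2
    · refine Finset.sum_congr rfl fun i _ => ?_
      push_cast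
      ring
    · refine Finset.sum_congr rfl fun i _ => ?_
      push_cast
      ring
    · funext u
      push_cast
      ring
  rw [e1, e2]
  simp only [zero_add, Finset.sum_sub_distrib, Finset.sum_const, Finset.card_range, nsmul_eq_mul,
    mul_one, hD]
  refine koszulSign_congr (r + t) ?_
  ring

theorem sum_desuspend_graft {φ : List M → W} (hφ : IsMultilinearOnWords k φ) {β : List M → M}
    (hβ : IsMultilinearOnWords k β) (a : ℕ → M) (deg : ℕ → ℤ) (ha : ∀ i, a i ∈ gr (deg i))
    (hmem : ∀ r s, 1 ≤ s →
      β (subword a r s) ∈ gr (∑ j ∈ Finset.range s, deg (r + j) + 2 - s)) (n : ℕ) :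
    ∑ r ∈ Finset.range n, ∑ s ∈ Finset.Icc 1 (n - r),
      ((r : ℤ) + s * (n - r - s : ℕ) + s * ∑ i ∈ Finset.range r, deg i).negOnePow •
        desuspend hφ κ (n + 1 - s)
          (fun i => graft a r s (desuspend hβ κ s fun j => a (r + j)) i) =
      koszulSign k (∑ i ∈ Finset.range n, ((n : ℤ) - 1 - i) * deg i) •
        coder (-κ) β (subword a 0 n) φ := by
  rw [coder_subword, Finset.smul_sum]
  refine Finset.sum_congr rfl fun r hr => ?_
  rw [Finset.smul_sum]
  refine Finset.sum_congr rfl fun s hs => ?_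
  rw [Finset.mem_range] at hr
  rw [Finset.mem_Icc] at hs
  have h := desuspend_graft hκ hφ hβ a deg ha r s (n - r - s) (n + 1 - s) (by omega) hs.1
    (hmem r s hs.1)
  rw [show r + s + (n - r - s) = n by omega] at h
  simpa only [zero_add] using h

end Desuspension

/-! ### Sums over compositions with at most two blocks -/

/-- The composition `m + 1 = (i + 1) + (m - i)` with two blocks. -/
def Composition.twoBlocks {m : ℕ} (i : Fin m) : Composition (m + 1) where
  blocks := [i + 1, m - i]
  blocks_pos := fun {j} hj => by
    have := i.2
    simp only [List.mem_cons, List.not_mem_nil, or_false] at hj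
    omega
  blocks_sum := by
    have := i.2
    simp only [List.sum_cons, List.sum_nil]
    omega

theorem Composition.sum_eq_single_add_twoBlocks {W : Type*} [AddCommMonoid W] {m : ℕ}
    (F : Composition (m + 1) → W) (hF : ∀ c, 3 ≤ c.length → F c = 0) :
    ∑ c, F c = F (Composition.single (m + 1) m.succ_pos) +
      ∑ i : Fin m, F (Composition.twoBlocks i) := by
  classical
  have hinj : Function.Injective (Composition.twoBlocks (m := m)) := by
    intro i j hij
    have h := congrArg Composition.blocks hij
    simp only [twoBlocks, List.cons.injEq] at h
    exact Fin.ext (by omega)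
  have hnot : Composition.single (m + 1) m.succ_pos ∉
      Finset.univ.image (Composition.twoBlocks (m := m)) := by
    rw [Finset.mem_image]
    rintro ⟨i, -, hi⟩
    have := congrArg Composition.length hi
    rw [Composition.single_length] at this
    simp [twoBlocks, Composition.length] at this
  rw [← Finset.sum_image (f := F) (s := Finset.univ) (g := Composition.twoBlocks)
    (fun i _ j _ h => hinj h), ← Finset.sum_insert hnot]
  refine (Finset.sum_subset (Finset.subset_univ _) fun c _ hc => hF c ?_).symm
  by_contra hlt
  apply hc
  rw [Finset.mem_insert, Finset.mem_image]
  have hsum := c.blocks_sum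
  have hpos : ∀ j ∈ c.blocks, 0 < j := fun j hj => c.blocks_pos hj
  obtain ⟨l, hl⟩ : ∃ l, l = c.blocks := ⟨_, rfl⟩
  rw [Composition.length, ← hl] at hlt
  rw [← hl] at hsum hpos
  rcases l with _ | ⟨u, _ | ⟨v, _ | ⟨w, l⟩⟩⟩
  · simp at hsum
  · left
    refine Composition.ext ?_
    simp only [List.sum_cons, List.sum_nil, add_zero] at hsum
    rw [← hl, hsum, Composition.single_blocks]
  · right
    simp only [List.sum_cons, List.sum_nil, add_zero] at hsum
    have hu := hpos u (by simp)
    have hv := hpos v (by simp)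
    refine ⟨⟨u - 1, by omega⟩, Finset.mem_univ _, Composition.ext ?_⟩
    rw [← hl]
    simp only [twoBlocks, List.cons.injEq, and_true]
    omega
  · simp only [List.length_cons] at hlt
    omega

section

variable {k A M : Type*} [Field k] [NonUnitalRing A] [Module k A] [AddCommGroup M]
    [Module k M] [IsScalarTower k A A] [SMulCommClass k A A] {κ : M →ₗ[k] M}
    {gr : ℤ → Submodule k M}

/-- For a dg-algebra `X` the right-hand side of the identities of an `A_∞`-morphism to `X` is
`d φ - φ ⋆ φ`. -/
theorem FilteredDGAlgebra.sum_composition (X : FilteredDGAlgebra k A)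
    (hκ : ∀ n, ∀ x ∈ gr n, κ x = koszulSign k n • x) {φ : List M → A}
    (hφ : IsMultilinearOnWords k φ) (hnil : φ [] = 0) (a : ℕ → M) (deg : ℕ → ℤ)
    (ha : ∀ i, a i ∈ gr (deg i)) (n : ℕ) (hn : 1 ≤ n) :
    ∑ c : Composition n,
      (∑ j : Fin c.length, ((c.length : ℤ) - 1 - j) * (c.blocksFun j - 1) +
        ∑ j : Fin c.length, (1 - (c.blocksFun j : ℤ)) *
          ∑ i ∈ Finset.range (c.sizeUpTo j), deg i).negOnePow •
        X.op c.length (fun j => desuspend hφ κ (c.blocksFun j) fun i => a (c.sizeUpTo j + i)) =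
      koszulSign k (∑ i ∈ Finset.range n, ((n : ℤ) - 1 - i) * deg i) •
        (X.d (φ (subword a 0 n)) - conv (fun x => φ (x.map (-κ))) φ (subword a 0 n)) := by
  obtain ⟨m, rfl⟩ := Nat.exists_eq_add_of_le' hn
  rw [Composition.sum_eq_single_add_twoBlocks _ fun c hc => by
    rw [X.op_eq_zero hc, zero_apply, smul_zero], smul_sub]
  have hdes : ∀ j q, desuspend hφ κ q (fun i => a (j + i)) =
      koszulSign k (∑ i ∈ Finset.range q, ((q : ℤ) - 1 - i) * deg (j + i)) •
        φ (subword a j q) := fun j q => by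
    have := desuspend_subword hκ hφ q (fun i => a (j + i)) (fun i => deg (j + i)) fun i _ => ha _
    rwa [subword_comp_add] at this
  refine (congrArg₂ (· + ·) ?_ ?_).trans (sub_eq_add_neg _ _).symm
  · change (∑ j : Fin 1, (((1 : ℕ) : ℤ) - 1 - j) * (((m + 1 : ℕ) : ℤ) - 1) +
        ∑ j : Fin 1, (1 - ((m + 1 : ℕ) : ℤ)) *
          ∑ i ∈ Finset.range (((Composition.single (m + 1) m.succ_pos).blocks.take j).sum),
            deg i).negOnePow •
        X.d (desuspend hφ κ (m + 1) fun i => a (0 + i)) = _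
    rw [hdes, map_smul]
    simp
  · have hs : conv (fun x => φ (x.map (-κ))) φ (subword a 0 (m + 1)) =
        ∑ i : Fin m, φ ((subword a 0 (i + 1)).map (-κ)) * φ (subword a (i + 1) (m - i)) := by
      rw [conv, splitSum_subword, Finset.sum_range_succ, Finset.sum_range_succ',
        Fin.sum_univ_eq_sum_range
          fun i => φ ((subword a 0 (i + 1)).map (-κ)) * φ (subword a (i + 1) (m - i))]
      simp only [subword_zero, List.map_nil, hnil, zero_mul, mul_zero, add_zero, zero_add,
        Nat.add_sub_add_right, Nat.sub_self]
    rw [hs, Finset.smul_sum, ← Finset.sum_neg_distrib]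
    refine Finset.sum_congr rfl fun i _ => ?_
    have him := i.2
    change (∑ j : Fin 2, (((2 : ℕ) : ℤ) - 1 - j) *
          (((Composition.twoBlocks i).blocksFun j : ℤ) - 1) +
        ∑ j : Fin 2, (1 - ((Composition.twoBlocks i).blocksFun j : ℤ)) *
          ∑ u ∈ Finset.range ((Composition.twoBlocks i).sizeUpTo j), deg u).negOnePow •
        (desuspend hφ κ (i + 1) (fun u => a (0 + u)) *
          desuspend hφ κ (m - i) fun u => a ((i + 1 + 0) + u)) = _
    rw [Fin.sum_univ_two, Fin.sum_univ_two]
    change ((((2 : ℕ) : ℤ) - 1 - ((0 : ℕ) : ℤ)) * (((i + 1 : ℕ) : ℤ) - 1) +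
        (((2 : ℕ) : ℤ) - 1 - ((1 : ℕ) : ℤ)) * (((m - i : ℕ) : ℤ) - 1) +
        ((1 - ((i + 1 : ℕ) : ℤ)) * (∑ u ∈ Finset.range 0, deg u) +
          (1 - ((m - i : ℕ) : ℤ)) * ∑ u ∈ Finset.range (i + 1 + 0), deg u)).negOnePow • _ = _
    have hσ := map_suspended_subword hκ hφ a deg ha 0 (i + 1) []
    simp only [List.append_nil] at hσ
    rw [hdes, hdes, hσ, negOnePow_smul_eq (k := k), smul_mul_smul_comm, smul_mul_assoc, smul_smul,
      smul_smul, ← koszulSign_add, ← koszulSign_add, ← koszulSign_add, add_zero, ← neg_smul,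
      neg_eq_neg_one_mul, ← koszulSign_one, ← koszulSign_add]
    congr 1
    obtain ⟨q, hq⟩ : ∃ q : ℕ, m = i + q := ⟨m - i, by omega⟩
    have hq' : m - i = q := by omega
    have hm : m + 1 = (i + 1) + q := by omega
    rw [hq', hm]
    simp only [Finset.sum_range_add _ _ q, zero_add, Finset.sum_sub_distrib, Finset.sum_const,
      Finset.card_range, nsmul_eq_mul, mul_one]
    have e1 : ∑ u ∈ Finset.range ((i : ℕ) + 1), ((((i : ℕ) + 1 + q : ℕ) : ℤ) - 1 - u) * deg u =
        ∑ u ∈ Finset.range ((i : ℕ) + 1), ((((i : ℕ) + 1 : ℕ) : ℤ) - 1 - u) * deg u +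
          q * ∑ u ∈ Finset.range ((i : ℕ) + 1), deg u := by
      rw [Finset.mul_sum, ← Finset.sum_add_distrib]
      refine Finset.sum_congr rfl fun u _ => ?_
      push_cast
      ring
    have e2 : ∑ u ∈ Finset.range q,
          ((((i : ℕ) + 1 + q : ℕ) : ℤ) - 1 - ((i + 1 + u : ℕ) : ℤ)) * deg (i + 1 + u) =
        ∑ u ∈ Finset.range q, ((q : ℤ) - 1 - u) * deg (i + 1 + u) := by
      refine Finset.sum_congr rfl fun u _ => ?_
      push_cast
      ring
    rw [e1, e2]
    refine koszulSign_congr (i - q * ∑ u ∈ Finset.range ((i : ℕ) + 1), deg u) ?_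
    simp only [Finset.sum_range_zero]
    push_cast
    ring

end

/-! ### Weights -/

/-- The word `w` consists of elements of the submodules `L P n` whose indices sum to the given
ones. -/
inductive WordWeight {k M : Type*} [Field k] [AddCommGroup M] [Module k M]
    (L : ℤ → ℤ → Submodule k M) : List M → ℤ → ℤ → Prop
  | nil : WordWeight L [] 0 0
  | cons {a : M} {w : List M} {P n P' n' : ℤ} (ha : a ∈ L P n) (hw : WordWeight L w P' n') :
      WordWeight L (a :: w) (P + P') (n + n')

namespace WordWeight

variable {k M : Type*} [Field k] [AddCommGroup M] [Module k M] {L : ℤ → ℤ → Submodule k M}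

theorem split {x y : List M} {P n : ℤ} (h : WordWeight L (x ++ y) P n) :
    ∃ P₁ n₁ P₂ n₂, WordWeight L x P₁ n₁ ∧ WordWeight L y P₂ n₂ ∧ P₁ + P₂ = P ∧ n₁ + n₂ = n := by
  induction x generalizing P n with
  | nil => exact ⟨0, 0, P, n, nil, h, zero_add _, zero_add _⟩
  | cons a x ih =>
    rcases h with _ | ⟨ha, hw⟩
    obtain ⟨P₁, n₁, P₂, n₂, h₁, h₂, rfl, rfl⟩ := ih hw
    exact ⟨_, _, P₂, n₂, cons ha h₁, h₂, add_assoc _ _ _, add_assoc _ _ _⟩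

theorem map {σ : M →ₗ[k] M} (hσ : ∀ P n x, x ∈ L P n → σ x ∈ L P n) {w : List M} {P n : ℤ}
    (h : WordWeight L w P n) : WordWeight L (w.map σ) P n := by
  induction h with
  | nil => exact nil
  | cons ha _ ih => exact cons (hσ _ _ _ ha) ih

theorem ofFn {s : ℕ} {a : Fin s → M} {P n : Fin s → ℤ} (h : ∀ i, a i ∈ L (P i) (n i)) :
    WordWeight L (List.ofFn a) (∑ i, P i) (∑ i, n i) := by
  induction s with
  | zero => exact nil
  | succ s ih =>
    rw [List.ofFn_succ, Fin.sum_univ_succ, Fin.sum_univ_succ]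
    exact cons (h 0) (ih fun i => h i.succ)

end WordWeight

namespace Contraction

variable {k A M : Type*} [Field k] [NonUnitalRing A] [Module k A] [AddCommGroup M]
    [Module k M] (C : Contraction k A M) {G : ℤ → ℤ → Submodule k A} {r : ℤ}
    (hmul : ∀ P P' n n' x y, x ∈ G P n → y ∈ G P' n' → x * y ∈ G (P + P') (n + n'))
    (hh : ∀ P n x, x ∈ G P n → C.h x ∈ G (P - r) (n - 1))
    {L : ℤ → ℤ → Submodule k M} (hi : ∀ P n x, x ∈ L P n → C.i x ∈ G P n)
    (hσ : ∀ P n x, x ∈ L P n → C.σ x ∈ L P n)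
include hmul hh hi hσ

theorem approx_mem (N : ℕ) {w : List M} {P n : ℤ} (hw : WordWeight L w P n) :
    C.approx N w ∈ G (P + (1 - w.length) * r) (n + 1 - w.length) := by
  induction N generalizing w P n with
  | zero => exact zero_mem _
  | succ N ih =>
    refine add_mem ?_ ?_
    · rcases hw with _ | ⟨ha, _ | ⟨hb, hw⟩⟩
      · exact (map_zero C.i).symm ▸ zero_mem _
      · simpa [letter] using hi _ _ _ ha
      · exact (map_zero C.i).symm ▸ zero_mem _
    · rw [conv, map_splitSum]
      refine splitSum_induction (P := (· ∈ G _ _)) (fun _ _ => add_mem) fun x y hxy => ?_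
      subst hxy
      obtain ⟨P₁, n₁, P₂, n₂, h₁, h₂, rfl, rfl⟩ := hw.split
      have := hh _ _ _ (hmul _ _ _ _ _ _ (ih (h₁.map hσ)) (ih h₂))
      convert this using 2
      · rw [List.length_append, List.length_map]
        push_cast
        ring
      · rw [List.length_append, List.length_map]
        push_cast
        ring

theorem twist_mem {w : List M} {P n : ℤ} (hw : WordWeight L w P n) :
    C.twist w ∈ G (P + (1 - w.length) * r) (n + 1 - w.length) :=
  C.approx_mem hmul hh hi hσ _ hw

theorem quad_mem {w : List M} {P n : ℤ} (hw : WordWeight L w P n) :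
    C.quad w ∈ G (P + (2 - w.length) * r) (n + 2 - w.length) := by
  refine splitSum_induction (P := (· ∈ G _ _)) (fun _ _ => add_mem) fun x y hxy => ?_
  subst hxy
  obtain ⟨P₁, n₁, P₂, n₂, h₁, h₂, rfl, rfl⟩ := hw.split
  have := hmul _ _ _ _ _ _ (C.twist_mem hmul hh hi hσ (h₁.map hσ)) (C.twist_mem hmul hh hi hσ h₂)
  convert this using 2
  · rw [List.length_append, List.length_map]
    push_cast
    ring
  · rw [List.length_append, List.length_map]
    push_cast
    ring

end Contraction

/-! ### Graded vector spaces with a filtration -/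

section Internal

variable {k V : Type*} [Field k] [AddCommGroup V] [Module k V]

/-- Linear maps on the summands of an internal direct sum glue. -/
theorem DirectSum.IsInternal.exists_linearMap {ι : Type*} [DecidableEq ι] {D : ι → Submodule k V}
    (hD : DirectSum.IsInternal D) {W : Type*} [AddCommGroup W] [Module k W]
    (l : ι → V →ₗ[k] W) : ∃ h : V →ₗ[k] W, ∀ i, ∀ x ∈ D i, h x = l i x := by
  let e := LinearEquiv.ofBijective (DirectSum.coeLinearMap D) hD
  refine ⟨DirectSum.toModule k ι W (fun i => l i ∘ₗ (D i).subtype) ∘ₗ e.symm.toLinearMap,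
    fun i x hx => ?_⟩
  have : e.symm x = DirectSum.lof k ι (fun i => D i) i ⟨x, hx⟩ := by
    rw [LinearEquiv.symm_apply_eq]
    exact (DirectSum.coeLinearMap_lof D i ⟨x, hx⟩).symm
  rw [LinearMap.comp_apply, LinearEquiv.coe_coe, this, DirectSum.toModule_lof]
  rfl

theorem LinearMap.ext_iSup {ι : Type*} {D : ι → Submodule k V} (hD : ⨆ i, D i = ⊤) {W : Type*}
    [AddCommGroup W] [Module k W] {f g : V →ₗ[k] W} (h : ∀ i, ∀ x ∈ D i, f x = g x) (x : V) :
    f x = g x := by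
  have hle : ⨆ i, D i ≤ LinearMap.eqLocus f g := iSup_le h
  exact hle (hD ▸ Submodule.mem_top : x ∈ ⨆ i, D i)

/-- A subspace onto which there is a graded retraction inherits the grading. -/
theorem DirectSum.IsInternal.comap_subtype {ι : Type*} [DecidableEq ι] {gr : ι → Submodule k V}
    (hgr : DirectSum.IsInternal gr) (W : Submodule k V) (e : V →ₗ[k] V)
    (he : ∀ i, ∀ x ∈ gr i, e x ∈ gr i) (heW : ∀ x, e x ∈ W) (heq : ∀ x ∈ W, e x = x) :
    DirectSum.IsInternal fun i => (gr i).comap W.subtype := by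
  rw [DirectSum.isInternal_submodule_iff_iSupIndep_and_iSup_eq_top]
  constructor
  · rw [iSupIndep_iff_finsetSum_eq_zero_imp_eq_zero]
    intro s v hv hs i hi
    have h := (iSupIndep_iff_finsetSum_eq_zero_imp_eq_zero gr).1 hgr.submodule_iSupIndep s
      (fun i => (v i : V)) hv (by simpa using congrArg W.subtype hs) i hi
    exact Subtype.ext h
  · rw [eq_top_iff]
    rintro ⟨x, hx⟩ -
    have hle : ⨆ i, gr i ≤ (⨆ i, (gr i).comap W.subtype).comap (e.codRestrict W heW) :=
      iSup_le fun i y hy => Submodule.mem_iSup_of_mem i (he i y hy)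
    have := hle (hgr.submodule_iSup_eq_top ▸ Submodule.mem_top : x ∈ ⨆ i, gr i)
    rw [Submodule.mem_comap] at this
    convert this
    exact (heq x hx).symm

theorem Submodule.exists_relative_complement {Z F : Submodule k V} (h : Z ≤ F) :
    ∃ C ≤ F, Disjoint C Z ∧ C ⊔ Z = F := by
  obtain ⟨K, hK⟩ := Submodule.exists_isCompl Z
  refine ⟨K ⊓ F, inf_le_right, hK.disjoint.symm.mono_left inf_le_left, ?_⟩
  rw [sup_comm, ← sup_inf_assoc_of_le K h, hK.sup_eq_top, top_inf_eq]

end Internal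

/-- A graded vector space with a decreasing filtration that is exhaustive and bounded below;
`Fil p n` is the subspace `F^p V^n`. -/
structure GradedFiltration (k : Type*) [Field k] (V : Type*) [AddCommGroup V] [Module k V] where
  gr : ℤ → Submodule k V
  isInternal : DirectSum.IsInternal gr
  Fil : ℤ → ℤ → Submodule k V
  Fil_le : ∀ p n, Fil p n ≤ gr n
  anti : ∀ n, Antitone fun p => Fil p n
  exhaustive : ∀ n x, x ∈ gr n → ∃ p, x ∈ Fil p n
  bounded : ∀ n, ∃ p, Fil p n = ⊥

namespace GradedFiltration

variable {k V : Type*} [Field k] [AddCommGroup V] [Module k V] (F : GradedFiltration k V)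

/-- The filtration induced on a graded retract. -/
def restrict (W : Submodule k V) (e : V →ₗ[k] V) (he : ∀ n, ∀ x ∈ F.gr n, e x ∈ F.gr n)
    (heW : ∀ x, e x ∈ W) (heq : ∀ x ∈ W, e x = x) : GradedFiltration k W where
  gr n := (F.gr n).comap W.subtype
  isInternal := F.isInternal.comap_subtype W e he heW heq
  Fil p n := (F.Fil p n).comap W.subtype
  Fil_le p n := Submodule.comap_mono (F.Fil_le p n)
  anti n _ _ h := Submodule.comap_mono (F.anti n h)
  exhaustive n x hx := F.exhaustive n x hx
  bounded n := by
    obtain ⟨p, hp⟩ := F.bounded n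
    refine ⟨p, ?_⟩
    rw [hp, ← Submodule.ker_subtype W]
    rfl

/-- A choice of complements of `F^{p+1} V^n` in `F^p V^n`. -/
structure IsSplitting (D : ℤ → ℤ → Submodule k V) : Prop where
  sup : ∀ p n, D p n ⊔ F.Fil (p + 1) n = F.Fil p n
  disjoint : ∀ p n, Disjoint (D p n) (F.Fil (p + 1) n)

theorem exists_isSplitting : ∃ D, F.IsSplitting D := by
  choose D _ h1 h2 using fun p n =>
    Submodule.exists_relative_complement
      (F.anti n (by omega : p ≤ p + 1) : F.Fil (p + 1) n ≤ F.Fil p n)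
  exact ⟨D, h2, h1⟩

variable {F} {D : ℤ → ℤ → Submodule k V} (hD : F.IsSplitting D)

namespace IsSplitting

include hD

theorem le (p n : ℤ) : D p n ≤ F.Fil p n := le_sup_left.trans (hD.sup p n).le

theorem fil_eq (p n : ℤ) : F.Fil p n = ⨆ q : ℤ, ⨆ _ : p ≤ q, D q n := by
  refine le_antisymm ?_ (iSup₂_le fun q hq => (hD.le q n).trans (F.anti n hq))
  obtain ⟨N, hN⟩ := F.bounded n
  rcases le_total N p with h | h
  · have : F.Fil p n ≤ F.Fil N n := F.anti n h
    exact (this.trans hN.le).trans bot_le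
  · obtain ⟨j, rfl⟩ : ∃ j : ℕ, N = p + j := ⟨(N - p).toNat, by omega⟩
    clear h
    induction j generalizing p with
    | zero =>
      simp only [Nat.cast_zero, add_zero] at hN
      exact hN.le.trans bot_le
    | succ j ih =>
      rw [← hD.sup p n]
      refine sup_le (le_iSup₂_of_le (f := fun q (_ : p ≤ q) => D q n) p le_rfl le_rfl)
        ((ih (p + 1) (by rw [← hN]; congr 1; push_cast; ring)).trans ?_)
      exact iSup₂_le fun q hq =>
        le_iSup₂_of_le (f := fun q (_ : p ≤ q) => D q n) q (by omega) le_rfl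

theorem gr_eq (n : ℤ) : F.gr n = ⨆ p : ℤ, D p n := by
  refine le_antisymm (fun x hx => ?_) (iSup_le fun p => (hD.le p n).trans (F.Fil_le p n))
  obtain ⟨p, hp⟩ := F.exhaustive n x hx
  rw [hD.fil_eq] at hp
  exact (iSup₂_le fun q _ => le_iSup (fun q => D q n) q :
    (⨆ q : ℤ, ⨆ _ : p ≤ q, D q n) ≤ ⨆ q : ℤ, D q n) hp

theorem isInternal : DirectSum.IsInternal fun i : ℤ × ℤ => D i.1 i.2 := by
  classical
  rw [DirectSum.isInternal_submodule_iff_iSupIndep_and_iSup_eq_top]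
  constructor
  · rw [iSupIndep_iff_finsetSum_eq_zero_imp_eq_zero]
    intro s v hv hs
    -- The components of a relation in each degree are relations.
    have hn : ∀ n, ∑ i ∈ s with i.2 = n, v i = 0 := by
      intro n
      by_cases hns : n ∈ s.image Prod.snd
      · refine (iSupIndep_iff_finsetSum_eq_zero_imp_eq_zero F.gr).1 F.isInternal.submodule_iSupIndep
          (s.image Prod.snd) (fun n => ∑ i ∈ s with i.2 = n, v i) (fun m _ => ?_) ?_ n hns
        · refine Submodule.sum_mem _ fun i hi => ?_
          rw [Finset.mem_filter] at hi
          have := F.Fil_le _ _ (hD.le _ _ (hv i hi.1))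
          rwa [hi.2] at this
        · rw [Finset.sum_fiberwise_of_maps_to fun i hi => Finset.mem_image_of_mem _ hi]
          exact hs
      · refine Finset.sum_eq_zero fun i hi => ?_
        rw [Finset.mem_filter] at hi
        exact absurd (Finset.mem_image.2 ⟨i, hi.1, hi.2⟩) hns
    intro i hi
    by_contra hne
    -- A term of lowest filtration lies in the next step of the filtration.
    obtain ⟨j, hj, hmin⟩ := Finset.exists_min_image ({u ∈ s | u.2 = i.2 ∧ v u ≠ 0})
      (fun u => u.1) ⟨i, by simp [hi, hne]⟩
    simp only [Finset.mem_filter] at hj hmin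
    have hj' : j ∈ ({u ∈ s | u.2 = i.2} : Finset (ℤ × ℤ)) := by simp [hj.1, hj.2.1]
    have h0 := hn i.2
    rw [← Finset.add_sum_erase _ _ hj'] at h0
    have hmem : ∑ u ∈ ({u ∈ s | u.2 = i.2} : Finset (ℤ × ℤ)).erase j, v u ∈
        F.Fil (j.1 + 1) j.2 := by
      refine Submodule.sum_mem _ fun u hu => ?_
      rw [Finset.mem_erase, Finset.mem_filter] at hu
      by_cases hu0 : v u = 0
      · rw [hu0]
        exact zero_mem _
      · have h1 := hmin u ⟨hu.2.1, hu.2.2, hu0⟩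
        have h2 : u.1 ≠ j.1 := fun h => hu.1 (Prod.ext h (hu.2.2.trans hj.2.1.symm))
        have h3 := hD.le _ _ (hv u hu.2.1)
        rw [hu.2.2, ← hj.2.1] at h3
        exact F.anti _ (by omega : j.1 + 1 ≤ u.1) h3
    refine hj.2.2 ((Submodule.disjoint_def.1 (hD.disjoint j.1 j.2)) _ (hv j hj.1) ?_)
    rw [eq_neg_of_add_eq_zero_left h0]
    exact neg_mem hmem
  · rw [eq_top_iff, ← F.isInternal.submodule_iSup_eq_top]
    refine iSup_le fun n => ?_
    rw [hD.gr_eq]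
    exact iSup_le fun p => le_iSup (fun i : ℤ × ℤ => D i.1 i.2) (p, n)

end IsSplitting

end GradedFiltration

/-! ### Contracting homotopies of filtered complexes -/

section Harmonic

variable {k V : Type*} [Field k] [AddCommGroup V] [Module k V]

/-- The subcomplex `ker h ∩ ker (h d)`, a complement of the image of `d h + h d` when `h d h = h`
and `h h = 0`. -/
def harmonicPart (d h : V →ₗ[k] V) : Submodule k V := LinearMap.ker h ⊓ LinearMap.ker (h ∘ₗ d)

/-- The projection `1 - d h - h d` onto `harmonicPart d h`. -/
def harmonicProj (d h : V →ₗ[k] V) : V →ₗ[k] V := LinearMap.id - d ∘ₗ h - h ∘ₗ d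

variable {d h : V →ₗ[k] V}

theorem mem_harmonicPart {x : V} : x ∈ harmonicPart d h ↔ h x = 0 ∧ h (d x) = 0 := Iff.rfl

theorem harmonicProj_apply (x : V) : harmonicProj d h x = x - d (h x) - h (d x) := rfl

theorem harmonicProj_of_mem {x : V} (hx : x ∈ harmonicPart d h) : harmonicProj d h x = x := by
  rw [mem_harmonicPart] at hx
  rw [harmonicProj_apply, hx.1, hx.2, map_zero, sub_zero, sub_zero]

theorem harmonicProj_mem (hdd : ∀ x, d (d x) = 0) (hdh : ∀ x, h (d (h x)) = h x)
    (hhh : ∀ x, h (h x) = 0) (x : V) : harmonicProj d h x ∈ harmonicPart d h := by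
  rw [mem_harmonicPart, harmonicProj_apply]
  simp only [map_sub, hdd, hdh, hhh, sub_self, sub_zero, and_self]

theorem d_mem_harmonicPart (hdd : ∀ x, d (d x) = 0) (x : V) (hx : x ∈ harmonicPart d h) :
    d x ∈ harmonicPart d h := by
  rw [mem_harmonicPart] at hx ⊢
  rw [hdd, map_zero]
  exact ⟨hx.2, rfl⟩

theorem harmonicProj_h (hdh : ∀ x, h (d (h x)) = h x) (hhh : ∀ x, h (h x) = 0) (x : V) :
    harmonicProj d h (h x) = 0 := by
  rw [harmonicProj_apply, hhh, hdh, map_zero, sub_zero, sub_self]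

theorem harmonicProj_d (hdd : ∀ x, d (d x) = 0) (x : V) :
    harmonicProj d h (d x) = d (harmonicProj d h x) := by
  simp only [harmonicProj_apply, map_sub, hdd, map_zero, sub_zero]

end Harmonic

namespace GradedFiltration

variable {k V : Type*} [Field k] [AddCommGroup V] [Module k V] (F : GradedFiltration k V)

theorem harmonicProj_mem_fil {d h : V →ₗ[k] V} {c c' : ℤ} (hc' : c' ≤ c)
    (hd : ∀ p n x, x ∈ F.Fil p n → d x ∈ F.Fil (p + c) (n + 1))
    (hh : ∀ p n x, x ∈ F.Fil p n → h x ∈ F.Fil (p - c') (n - 1)) (p n : ℤ) (x : V)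
    (hx : x ∈ F.Fil p n) : harmonicProj d h x ∈ F.Fil p n := by
  have h1 := hd _ _ _ (hh _ _ _ hx)
  have h2 := hh _ _ _ (hd _ _ _ hx)
  rw [sub_add_cancel] at h1
  rw [add_sub_cancel_right] at h2
  exact sub_mem (sub_mem hx (F.anti n (by omega : p ≤ p - c' + c) h1))
    (F.anti n (by omega : p ≤ p + c - c') h2)

/-- If `d` raises the filtration by `c`, then the part of `d` that raises it by exactly `c` can be
split off by a homotopy lowering the filtration by `c`. Let `C^p` be a complement in `F^p` of the
elements whose differential lies in `F^{p+c+1}`; the homotopy is inverse to `d : C^p → d C^p`. -/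
theorem exists_homotopy_step (d : V →ₗ[k] V) (hdd : ∀ x, d (d x) = 0) (c : ℤ)
    (hd : ∀ p n x, x ∈ F.Fil p n → d x ∈ F.Fil (p + c) (n + 1)) :
    ∃ h : V →ₗ[k] V, (∀ x, h (d (h x)) = h x) ∧ (∀ x, h (h x) = 0) ∧
      (∀ p n x, x ∈ F.Fil p n → h x ∈ F.Fil (p - c) (n - 1)) ∧
      ∀ p n x, x ∈ F.Fil p n → x ∈ harmonicPart d h → d x ∈ F.Fil (p + c + 1) (n + 1) := by
  let Z : ℤ → ℤ → Submodule k V := fun p n => F.Fil p n ⊓ (F.Fil (p + c + 1) (n + 1)).comap d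
  have hFZ : ∀ p n, F.Fil (p + 1) n ≤ Z p n := fun p n x hx =>
    ⟨F.anti n (by omega : p ≤ p + 1) hx, by
      have := hd _ _ _ hx
      rwa [add_right_comm] at this⟩
  choose C hCF hCZ hCsup using fun p n =>
    Submodule.exists_relative_complement (inf_le_left : Z p n ≤ F.Fil p n)
  have key : ∀ p n u v, u ∈ C p n → v ∈ C (p - c) (n - 1) → u + d v ∈ F.Fil (p + 1) n →
      u = 0 ∧ v = 0 := by
    intro p n u v hu hv huv
    have hu0 : u = 0 := by
      refine Submodule.disjoint_def.1 (hCZ p n) u hu ⟨hCF _ _ hu, ?_⟩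
      have := hd _ _ _ huv
      rw [map_add, hdd, add_zero, add_right_comm] at this
      exact this
    refine ⟨hu0, Submodule.disjoint_def.1 (hCZ _ _) v hv ⟨hCF _ _ hv, ?_⟩⟩
    rw [hu0, zero_add] at huv
    change d v ∈ F.Fil (p - c + c + 1) (n - 1 + 1)
    rwa [sub_add_cancel, sub_add_cancel]
  let X : ℤ → ℤ → Submodule k V := fun p n => C p n ⊔ (C (p - c) (n - 1)).map d
  have hXF : ∀ p n, X p n ≤ F.Fil p n := fun p n => sup_le (hCF p n) <| by
    rintro _ ⟨v, hv, rfl⟩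
    have := hd _ _ _ (hCF _ _ hv)
    rwa [sub_add_cancel, sub_add_cancel] at this
  choose E hEF hEX hEsup using fun p n => Submodule.exists_relative_complement
    (sup_le (hXF p n) (F.anti n (by omega : p ≤ p + 1)) : X p n ⊔ F.Fil (p + 1) n ≤ F.Fil p n)
  let D : ℤ → ℤ → Submodule k V := fun p n => X p n ⊔ E p n
  have hD : F.IsSplitting D := by
    refine ⟨fun p n => ?_, fun p n => Submodule.disjoint_def.2 fun x hx hxF => ?_⟩
    · rw [← hEsup p n, sup_right_comm, sup_comm]
    · obtain ⟨y, hy, e, he, rfl⟩ := Submodule.mem_sup.1 hx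
      have he0 : e = 0 := Submodule.disjoint_def.1 (hEX p n) e he <| by
        rw [← add_sub_cancel_left y e]
        exact sub_mem (Submodule.mem_sup_right hxF) (Submodule.mem_sup_left hy)
      subst he0
      obtain ⟨u, hu, _, ⟨v, hv, rfl⟩, rfl⟩ := Submodule.mem_sup.1 hy
      rw [add_zero] at hxF
      obtain ⟨rfl, rfl⟩ := key p n u v hu hv hxF
      simp
  have hl : ∀ p n, ∃ l : V →ₗ[k] V, (∀ u ∈ C p n, l u = 0) ∧
      (∀ v ∈ C (p - c) (n - 1), l (d v) = v) ∧ ∀ x, l x ∈ C (p - c) (n - 1) := by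
    intro p n
    let N := C p n
    let g : C (p - c) (n - 1) →ₗ[k] V ⧸ N := N.mkQ ∘ₗ d ∘ₗ (C (p - c) (n - 1)).subtype
    have hg : LinearMap.ker g = ⊥ := by
      rw [Submodule.eq_bot_iff]
      rintro ⟨v, hv⟩ hgv
      have hvN : d v ∈ N := (Submodule.Quotient.mk_eq_zero N).1 hgv
      refine Subtype.ext (key p n (-d v) v (neg_mem hvN) hv ?_).2
      rw [neg_add_cancel]
      exact zero_mem _
    obtain ⟨g', hg'⟩ := g.exists_leftInverse_of_injective hg
    refine ⟨(C (p - c) (n - 1)).subtype ∘ₗ g' ∘ₗ N.mkQ, fun u hu => ?_, fun v hv => ?_,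
      fun x => (g' (N.mkQ x)).2⟩
    · have : N.mkQ u = 0 := (Submodule.Quotient.mk_eq_zero N).2 hu
      simp only [LinearMap.comp_apply, this, map_zero]
    · exact congrArg Subtype.val (LinearMap.congr_fun hg' ⟨v, hv⟩)
  choose l hlC hld hlmem using hl
  obtain ⟨h, hh⟩ := hD.isInternal.exists_linearMap fun i => l i.1 i.2
  replace hh : ∀ p n x, x ∈ D p n → h x = l p n x := fun p n => hh (p, n)
  have hhC : ∀ p n u, u ∈ C p n → h u = 0 := fun p n u hu => by
    rw [hh p n u (Submodule.mem_sup_left (Submodule.mem_sup_left hu)), hlC p n u hu]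
  have hhd : ∀ p n u, u ∈ C p n → h (d u) = u := fun p n u hu => by
    have hu' : u ∈ C (p + c - c) (n + 1 - 1) := by
      rwa [add_sub_cancel_right, add_sub_cancel_right]
    rw [hh (p + c) (n + 1) (d u)
      (Submodule.mem_sup_left (Submodule.mem_sup_right ⟨u, hu', rfl⟩)), hld _ _ u hu']
  have hhmem : ∀ p n x, x ∈ D p n → h x ∈ C (p - c) (n - 1) := fun p n x hx => by
    rw [hh p n x hx]
    exact hlmem p n x
  have htop := hD.isInternal.submodule_iSup_eq_top
  have hhF : ∀ p n x, x ∈ F.Fil p n → h x ∈ F.Fil (p - c) (n - 1) := by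
    intro p n x hx
    have hle : F.Fil p n ≤ (F.Fil (p - c) (n - 1)).comap h := by
      rw [hD.fil_eq]
      exact iSup₂_le fun q hq y hy =>
        F.anti _ (by omega : p - c ≤ q - c) (hCF _ _ (hhmem q n y hy))
    exact hle hx
  refine ⟨h, LinearMap.ext_iSup (f := h ∘ₗ d ∘ₗ h) (g := h) htop fun i x hx =>
      hhd _ _ _ (hhmem _ _ x hx),
    LinearMap.ext_iSup (f := h ∘ₗ h) (g := 0) htop fun i x hx => hhC _ _ _ (hhmem _ _ x hx),
    hhF, fun p n x hx hxh => ?_⟩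
  rw [← hCsup p n] at hx
  obtain ⟨u, hu, z, hz, rfl⟩ := Submodule.mem_sup.1 hx
  have hz' := hhF _ _ _ hz.2
  have h0 := (mem_harmonicPart.1 hxh).2
  rw [map_add, map_add, hhd _ _ u hu] at h0
  have hu0 : u = 0 := by
    refine Submodule.disjoint_def.1 (hCZ p n) u hu (hFZ p n ?_)
    rw [eq_neg_of_add_eq_zero_left h0]
    rw [add_right_comm, add_sub_cancel_right, add_sub_cancel_right] at hz'
    exact neg_mem hz'
  rw [hu0, zero_add]
  exact hz.2

/-- Iterating `exists_homotopy_step`, the parts of `d` that raise the filtration by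
`c, …, c + j - 1` are split off. The projection preserves the filtration, although this does not
follow from the bounds on `d` and `h`: it is the composite of the projections of the steps. -/
theorem exists_homotopy (j : ℕ) {V : Type v} [AddCommGroup V] [Module k V]
    (F : GradedFiltration k V) (d : V →ₗ[k] V) (hdd : ∀ x, d (d x) = 0) (c : ℤ)
    (hd : ∀ p n x, x ∈ F.Fil p n → d x ∈ F.Fil (p + c) (n + 1)) :
    ∃ h : V →ₗ[k] V, (∀ x, h (d (h x)) = h x) ∧ (∀ x, h (h x) = 0) ∧
      (∀ p n x, x ∈ F.Fil p n → h x ∈ F.Fil (p - (c + j - 1)) (n - 1)) ∧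
      (∀ p n x, x ∈ F.Fil p n → x ∈ harmonicPart d h → d x ∈ F.Fil (p + (c + j)) (n + 1)) ∧
      ∀ p n x, x ∈ F.Fil p n → harmonicProj d h x ∈ F.Fil p n := by
  induction j generalizing V c with
  | zero =>
    exact ⟨0, fun _ => rfl, fun _ => rfl, fun _ _ _ _ => zero_mem _, fun p n x hx _ => by
      simpa using hd p n x hx, fun p n x hx => by simpa [harmonicProj_apply] using hx⟩
  | succ j ih =>
    obtain ⟨h₁, hdh₁, hhh₁, hF₁, hM₁⟩ := F.exists_homotopy_step d hdd c hd
    let W := harmonicPart d h₁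
    let e := harmonicProj d h₁
    have heW : ∀ x, e x ∈ W := harmonicProj_mem hdd hdh₁ hhh₁
    have heq : ∀ x ∈ W, e x = x := fun x hx => harmonicProj_of_mem hx
    have heF := F.harmonicProj_mem_fil le_rfl hd hF₁
    have heg : ∀ n, ∀ x ∈ F.gr n, e x ∈ F.gr n := fun n x hx => by
      obtain ⟨p, hp⟩ := F.exhaustive n x hx
      exact F.Fil_le _ _ (heF p n x hp)
    let d' : W →ₗ[k] W := d.restrict (d_mem_harmonicPart hdd)
    obtain ⟨h₂, hdh₂, hhh₂, hF₂, hM₂, he₂⟩ := ih (F.restrict W e heg heW heq) d'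
      (fun x => Subtype.ext (hdd x)) (c + 1) fun p n x hx => by
        have := hM₁ p n x hx x.2
        rw [add_assoc] at this
        exact this
    let e' : V →ₗ[k] W := e.codRestrict W heW
    have he'W : ∀ x : W, e' x = x := fun x => Subtype.ext (heq x x.2)
    have he'h : ∀ x, e' (h₁ x) = 0 := fun x => Subtype.ext (harmonicProj_h hdh₁ hhh₁ x)
    have he'd : ∀ x, e' (d x) = d' (e' x) := fun x => Subtype.ext (harmonicProj_d hdd x)
    have h₁W : ∀ x : W, h₁ x = 0 := fun x => x.2.1
    have h₁dW : ∀ x : W, h₁ (d x) = 0 := fun x => x.2.2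
    let h : V →ₗ[k] V := h₁ + W.subtype ∘ₗ h₂ ∘ₗ e'
    have hh : ∀ x, h x = h₁ x + h₂ (e' x) := fun x => rfl
    have hhdh : ∀ x, h₁ (d (h x)) = h₁ x := fun x => by
      rw [hh, map_add, map_add, hdh₁, h₁dW, add_zero]
    have he'dh : ∀ x, e' (d (h x)) = d' (h₂ (e' x)) := fun x => by
      rw [he'd, hh, map_add, he'h, he'W, zero_add]
    refine ⟨h, fun x => ?_, fun x => ?_, fun p n x hx => ?_, fun p n x hx hxh => ?_,
      fun p n x hx => ?_⟩
    · rw [hh (d (h x)), hhdh, he'dh, hdh₂, ← hh]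
    · rw [hh (h x), hh x, map_add, map_add, hhh₁, h₁W, he'h, he'W]
      simp only [zero_add, hhh₂, ZeroMemClass.coe_zero]
    · refine add_mem (F.anti _ ?_ (hF₁ p n x hx)) ?_
      · push_cast
        omega
      · have h2 := hF₂ p n (e' x) (heF p n x hx)
        have e1 : p - (c + 1 + (j : ℤ) - 1) = p - (c + ((j + 1 : ℕ) : ℤ) - 1) := by
          push_cast
          ring
        rw [e1] at h2
        exact h2
    · rw [mem_harmonicPart] at hxh
      have hx1 : h₁ x = 0 := by rw [← hhdh, hxh.1, map_zero, map_zero]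
      have hx2 : h₁ (d x) = 0 := by rw [← hhdh, hxh.2, map_zero, map_zero]
      have hxW : x ∈ W := ⟨hx1, hx2⟩
      have hx' : e' x = ⟨x, hxW⟩ := he'W ⟨x, hxW⟩
      have hx3 : h₂ ⟨x, hxW⟩ = 0 := by
        have := hxh.1
        rw [hh, hx1, zero_add, hx'] at this
        exact Subtype.ext this
      have hx4 : h₂ (d' ⟨x, hxW⟩) = 0 := by
        have := hxh.2
        rw [hh, hx2, zero_add, he'd, hx'] at this
        exact Subtype.ext this
      have h2 := hM₂ p n ⟨x, hxW⟩ hx ⟨hx3, hx4⟩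
      have e1 : p + (c + 1 + (j : ℤ)) = p + (c + ((j + 1 : ℕ) : ℤ)) := by
        push_cast
        ring
      rw [e1] at h2
      exact h2
    · have e1 : harmonicProj d h x = harmonicProj d' h₂ (e' x) := by
        have e2 : ((e' x : W) : V) = x - d (h₁ x) - h₁ (d x) := rfl
        have e3 : ((d' (h₂ (e' x)) : W) : V) = d (h₂ (e' x)) := rfl
        rw [harmonicProj_apply, harmonicProj_apply, hh, hh, he'd, AddSubgroupClass.coe_sub,
          AddSubgroupClass.coe_sub, e2, e3, map_add]
        abel
      rw [e1]
      exact he₂ p n (e' x) (heF p n x hx)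

end GradedFiltration

/-! ### Quasi-isomorphisms of pages from filtered homotopies -/

namespace FilteredComplex.Hom

variable {k : Type*} [Field k] {V W : Type*} [AddCommGroup V] [Module k V]
  [AddCommGroup W] [Module k W] {X : FilteredComplex k V} {Y : FilteredComplex k W}

/-- A filtered map with a strict left inverse that is inverse to it up to a homotopy lowering the
filtration by `r` induces a quasi-isomorphism of the pages `E_r`. -/
theorem isPageQuasiIso_of_homotopy (φ : Hom X Y) (ψ : Hom Y X) (hψφ : ∀ x, ψ.f (φ.f x) = x)
    (r : ℤ) (h : W →ₗ[k] W) (hh : ∀ p n y, y ∈ Y.Fil p n → h y ∈ Y.Fil (p - r) (n - 1))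
    (hdh : ∀ y, Y.d (h y) + h (Y.d y) + φ.f (ψ.f y) = y) : φ.IsPageQuasiIso r := by
  have hdh' : ∀ y, Y.d (h y) = y - φ.f (ψ.f y) - h (Y.d y) := fun y => by
    rw [sub_sub, eq_sub_iff_add_eq, add_comm (φ.f _), ← add_assoc, hdh]
  have hφψ : ∀ p n y, y ∈ Y.Fil p n → φ.f (ψ.f y) ∈ Y.Fil p n := fun p n y hy =>
    φ.map_mem _ _ _ (ψ.map_mem _ _ _ hy)
  -- The homotopy maps `Z_s^p` to `Z_s^{p-r}` as soon as `s ≤ r`.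
  have hZ : ∀ s p n y, s ≤ r → y ∈ Y.Z s p n → h y ∈ Y.Z s (p - r) (n - 1) := by
    intro s p n y hs hy
    refine ⟨hh _ _ _ hy.1, ?_⟩
    change Y.d (h y) ∈ Y.Fil (p - r + s) (n - 1 + 1)
    have h1 := hh _ _ _ hy.2
    rw [add_sub_cancel_right] at h1
    rw [sub_add_cancel, hdh']
    exact sub_mem (sub_mem (Y.anti n (by omega : p - r + s ≤ p) hy.1)
      (Y.anti n (by omega : p - r + s ≤ p) (hφψ _ _ _ hy.1)))
      (Y.anti n (by omega : p - r + s ≤ p + s - r) h1)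
  have hB : ∀ p n y, y ∈ Y.B r p n → h y ∈ Y.B r (p - r) (n - 1) := by
    intro p n y hy
    obtain ⟨u, hu, _, ⟨v, hv, rfl⟩, rfl⟩ := Submodule.mem_sup.1 hy
    have hv' : v ∈ Y.Z (r - 1) (p - r + 1) (n - 1) := hv
    rw [map_add]
    have h1 := hZ _ _ _ _ (by omega) hu
    have h2 := hZ _ _ _ _ (by omega) hv'
    rw [add_sub_right_comm] at h1
    refine add_mem (Submodule.mem_sup_left h1) ?_
    have h3 : h (Y.d v) = v - φ.f (ψ.f v) - Y.d (h v) := by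
      rw [hdh' v]
      abel
    rw [h3]
    refine sub_mem (Submodule.mem_sup_left (sub_mem hv' ?_)) (Submodule.mem_sup_right ⟨_, ?_, rfl⟩)
    · exact φ.map_mem_Z _ _ _ _ (ψ.map_mem_Z _ _ _ _ hv')
    · rwa [add_sub_right_comm] at h2
  intro p n
  constructor
  · have hinv : ∀ x, ψ.pageCohomologyMap r p n (φ.pageCohomologyMap r p n x) = x := by
      intro x
      obtain ⟨⟨x, hx⟩, rfl⟩ := Submodule.Quotient.mk_surjective _ x
      obtain ⟨x, rfl⟩ := Submodule.Quotient.mk_surjective _ x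
      refine congrArg Submodule.Quotient.mk (Subtype.ext ?_)
      exact congrArg Submodule.Quotient.mk (Subtype.ext (hψφ x.1))
    exact Function.LeftInverse.injective hinv
  · intro y
    refine ⟨ψ.pageCohomologyMap r p n y, ?_⟩
    obtain ⟨⟨y, hy⟩, rfl⟩ := Submodule.Quotient.mk_surjective _ y
    obtain ⟨y, rfl⟩ := Submodule.Quotient.mk_surjective _ y
    symm
    refine (Submodule.Quotient.eq _).2 ?_
    have hdB : Y.d y.1 ∈ Y.B r (p + r) (n + 1) := (Submodule.Quotient.mk_eq_zero
      ((Y.B r (p + r) (n + 1)).submoduleOf (Y.Z r (p + r) (n + 1)))).1 hy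
    have h1 := hB _ _ _ hdB
    rw [add_sub_cancel_right, add_sub_cancel_right] at h1
    refine ⟨Submodule.Quotient.mk ⟨h y.1, hZ _ _ _ _ le_rfl y.2⟩, ?_⟩
    refine (Submodule.Quotient.eq _).2 ?_
    change Y.d (h y.1) - (y.1 - φ.f (ψ.f y.1)) ∈ Y.B r p n
    rw [hdh', sub_sub_cancel_left]
    exact neg_mem h1

end FilteredComplex.Hom

/-! ### The minimal model -/

namespace Contraction

variable {k A M : Type*} [Field k] [NonUnitalRing A] [Module k A] [AddCommGroup M]
    [Module k M] (C : Contraction k A M)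

theorem quad_nil : C.quad [] = 0 := by simp [quad, conv, splitSum, twist_nil]

theorem quad_singleton (a : M) : C.quad [a] = 0 := by simp [quad, conv, splitSum, twist_nil]

theorem bar_nil : C.bar [] = 0 := by simp [bar, letter, quad_nil]

theorem bar_singleton (a : M) : C.bar [a] = C.dM a := by simp [bar, letter, quad_singleton]

theorem twist_singleton (a : M) : C.twist [a] = C.i a := by
  simp [twist_eq, letter, quad_singleton]

theorem bar_mem {G : ℤ → ℤ → Submodule k A} {r : ℤ}
    (hmul : ∀ P P' n n' x y, x ∈ G P n → y ∈ G P' n' → x * y ∈ G (P + P') (n + n'))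
    (hh : ∀ P n x, x ∈ G P n → C.h x ∈ G (P - r) (n - 1))
    {L : ℤ → ℤ → Submodule k M} (hi : ∀ P n x, x ∈ L P n → C.i x ∈ G P n)
    (hσ : ∀ P n x, x ∈ L P n → C.σ x ∈ L P n)
    (hp : ∀ P n x, x ∈ G P n → C.p x ∈ L P n)
    (hd : ∀ P n x, x ∈ L P n → C.dM x ∈ L (P + r) (n + 1))
    {w : List M} {P n : ℤ} (hw : WordWeight L w P n) :
    C.bar w ∈ L (P + (2 - w.length) * r) (n + 2 - w.length) := by
  refine sub_mem ?_ (hp _ _ _ (C.quad_mem hmul hh hi hσ hw))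
  rcases hw with _ | ⟨ha, _ | ⟨hb, hw⟩⟩
  · exact (map_zero C.dM).symm ▸ zero_mem _
  · have h := hd _ _ _ ha
    simp only [List.length_singleton, Nat.cast_one, add_zero]
    convert h using 2 <;> first | rfl | ring
  · exact (map_zero C.dM).symm ▸ zero_mem _

end Contraction

namespace FilteredDGAlgebra

variable {k : Type u} [Field k] {A : Type v} [NonUnitalRing A] [Module k A]

/-- The grading and filtration of a filtered dg-algebra. -/
def toGradedFiltration (X : FilteredDGAlgebra k A) : GradedFiltration k A where
  gr := X.gr
  isInternal := X.isInternal
  Fil := X.Fil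
  Fil_le := X.Fil_le
  anti := X.Fil_anti
  exhaustive := X.Fil_exhaustive
  bounded := X.Fil_bounded

/-- A homotopy on a filtered dg-algebra that lowers the filtration by `r` and splits off a
contractible complex, leaving a complement on which `d` raises the filtration by `r + 1`. The
parity operator `κ` of `A` is recorded along with it. -/
structure MinimalHomotopy (X : FilteredDGAlgebra k A) (r : ℕ) where
  h : A →ₗ[k] A
  h_d_h : ∀ x, h (X.d (h x)) = h x
  h_h : ∀ x, h (h x) = 0
  h_mem : ∀ p n x, x ∈ X.Fil p n → h x ∈ X.Fil (p - r) (n - 1)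
  d_mem : ∀ p n x, x ∈ X.Fil p n → x ∈ harmonicPart X.d h → X.d x ∈ X.Fil (p + r + 1) (n + 1)
  proj_mem : ∀ p n x, x ∈ X.Fil p n → harmonicProj X.d h x ∈ X.Fil p n
  κ : A →ₗ[k] A
  κ_apply : ∀ n, ∀ x ∈ X.gr n, κ x = koszulSign k n • x

theorem exists_minimalHomotopy (X : FilteredDGAlgebra k A) (r : ℕ) :
    Nonempty (X.MinimalHomotopy r) := by
  obtain ⟨h, h1, h2, h3, h4, h5⟩ := X.toGradedFiltration.exists_homotopy (r + 1) X.d X.d_d 0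
    fun p n x hx => by
      rw [add_zero]
      exact X.Fil_d p n x hx
  obtain ⟨κ, hκ⟩ := X.isInternal.exists_linearMap
    fun n => koszulSign k n • (LinearMap.id : A →ₗ[k] A)
  refine ⟨⟨h, h1, h2, fun p n x hx => ?_, fun p n x hx hxh => ?_, h5, κ, hκ⟩⟩
  · have := h3 p n x hx
    rwa [show p - (0 + ((r + 1 : ℕ) : ℤ) - 1) = p - r by push_cast; ring] at this
  · have := h4 p n x hx hxh
    rwa [show p + (0 + ((r + 1 : ℕ) : ℤ)) = p + r + 1 by push_cast; ring] at this

namespace MinimalHomotopy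

variable {X : FilteredDGAlgebra k A} {r : ℕ} (H : X.MinimalHomotopy r)

/-- The space underlying the minimal model. -/
abbrev Space : Type v := harmonicPart X.d H.h

/-- The grading of the minimal model, induced from `A`. -/
def gr (n : ℤ) : Submodule k H.Space := (X.gr n).comap (harmonicPart X.d H.h).subtype

/-- The filtration of the minimal model, induced from `A`. -/
def fil (p n : ℤ) : Submodule k H.Space := (X.Fil p n).comap (harmonicPart X.d H.h).subtype

theorem h_mem_gr (n : ℤ) (x : A) (hx : x ∈ X.gr n) : H.h x ∈ X.gr (n - 1) := by
  obtain ⟨p, hp⟩ := X.Fil_exhaustive n x hx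
  exact X.Fil_le _ _ (H.h_mem p n x hp)

theorem proj_mem_gr (n : ℤ) (x : A) (hx : x ∈ X.gr n) : harmonicProj X.d H.h x ∈ X.gr n := by
  obtain ⟨p, hp⟩ := X.Fil_exhaustive n x hx
  exact X.Fil_le _ _ (H.proj_mem p n x hp)

theorem d_κ (x : A) : X.d (H.κ x) = -H.κ (X.d x) := by
  refine LinearMap.ext_iSup (f := X.d ∘ₗ H.κ) (g := -(H.κ ∘ₗ X.d))
    X.isInternal.submodule_iSup_eq_top (fun n x hx => ?_) x
  simp only [LinearMap.comp_apply, LinearMap.neg_apply]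
  rw [H.κ_apply n x hx, H.κ_apply _ _ (X.d_mem n x hx), map_smul, koszulSign_add, koszulSign_one,
    mul_neg_one, neg_smul, neg_neg]

theorem h_κ (x : A) : H.h (H.κ x) = -H.κ (H.h x) := by
  refine LinearMap.ext_iSup (f := H.h ∘ₗ H.κ) (g := -(H.κ ∘ₗ H.h))
    X.isInternal.submodule_iSup_eq_top (fun n x hx => ?_) x
  simp only [LinearMap.comp_apply, LinearMap.neg_apply]
  rw [H.κ_apply n x hx, H.κ_apply _ _ (H.h_mem_gr n x hx), map_smul, sub_eq_add_neg,
    koszulSign_add, koszulSign_congr (-1) (m := -1) (n := 1) rfl, koszulSign_one,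
    mul_neg_one, neg_smul, neg_neg]

theorem κ_κ (x : A) : H.κ (H.κ x) = x := by
  refine LinearMap.ext_iSup (f := H.κ ∘ₗ H.κ) (g := LinearMap.id)
    X.isInternal.submodule_iSup_eq_top (fun n x hx => ?_) x
  simp only [LinearMap.comp_apply, LinearMap.id_apply]
  rw [H.κ_apply n x hx, map_smul, H.κ_apply n x hx, smul_smul, koszulSign_mul_self, one_smul]

theorem κ_mem (x : A) (hx : x ∈ harmonicPart X.d H.h) : H.κ x ∈ harmonicPart X.d H.h := by
  rw [mem_harmonicPart] at hx ⊢
  rw [h_κ, d_κ, map_neg, h_κ, hx.1, hx.2, map_zero, neg_zero, neg_zero]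
  exact ⟨rfl, rfl⟩

theorem fil_le_gr (p n : ℤ) : H.fil p n ≤ H.gr n := fun _ hx => X.Fil_le p n hx

theorem gr_isInternal : DirectSum.IsInternal H.gr :=
  X.isInternal.comap_subtype _ _ H.proj_mem_gr (harmonicProj_mem X.d_d H.h_d_h H.h_h)
    fun _ => harmonicProj_of_mem

/-- The graded filtration of the harmonic part. -/
def gradedFiltration : GradedFiltration k H.Space :=
  X.toGradedFiltration.restrict _ (harmonicProj X.d H.h) H.proj_mem_gr
    (harmonicProj_mem X.d_d H.h_d_h H.h_h) fun _ => harmonicProj_of_mem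

variable {D : ℤ → ℤ → Submodule k H.Space} (hD : H.gradedFiltration.IsSplitting D)

include hD in
theorem mem_iSup_of_mem_fil {p n : ℤ} {x : H.Space} (hx : x ∈ H.fil p n) :
    x ∈ ⨆ j : ℕ, D (p + j) n := by
  have hle : H.fil p n ≤ ⨆ j : ℕ, D (p + j) n := by
    rw [show H.fil p n = _ from hD.fil_eq p n]
    refine iSup₂_le fun q hq => ?_
    obtain ⟨j, rfl⟩ : ∃ j : ℕ, q = p + j := ⟨(q - p).toNat, by omega⟩
    exact le_iSup (fun j : ℕ => D (p + j) n) j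
  exact hle hx

variable [IsScalarTower k A A]

theorem leibniz (x y : A) : X.d (x * y) = X.d x * y + H.κ x * X.d y := by
  refine LinearMap.ext_iSup (f := X.d ∘ₗ LinearMap.mulRight k y)
    (g := LinearMap.mulRight k y ∘ₗ X.d + LinearMap.mulRight k (X.d y) ∘ₗ H.κ)
    X.isInternal.submodule_iSup_eq_top (fun n x hx => ?_) x
  simp only [LinearMap.comp_apply, LinearMap.mulRight_apply, LinearMap.add_apply]
  rw [X.leibniz n x y hx, H.κ_apply n x hx, negOnePow_smul_eq (k := k), smul_mul_assoc]

variable [SMulCommClass k A A]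

theorem κ_mul (x y : A) : H.κ (x * y) = H.κ x * H.κ y := by
  have htop := X.isInternal.submodule_iSup_eq_top
  refine LinearMap.ext_iSup (f := H.κ ∘ₗ LinearMap.mulRight k y)
    (g := LinearMap.mulRight k (H.κ y) ∘ₗ H.κ) htop (fun m x hx => ?_) x
  refine LinearMap.ext_iSup (f := H.κ ∘ₗ LinearMap.mulLeft k x)
    (g := LinearMap.mulLeft k (H.κ x) ∘ₗ H.κ) htop (fun n y hy => ?_) y
  simp only [LinearMap.comp_apply, LinearMap.mulLeft_apply]
  rw [H.κ_apply m x hx, H.κ_apply n y hy, H.κ_apply _ _ (X.mul_mem _ _ _ _ hx hy),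
    koszulSign_add, smul_mul_smul_comm]

/-- The contraction of `A` onto the harmonic part. -/
def contraction : Contraction k A H.Space where
  d := X.d
  h := H.h
  κ := H.κ
  i := (harmonicPart X.d H.h).subtype
  p := (harmonicProj X.d H.h).codRestrict _ (harmonicProj_mem X.d_d H.h_d_h H.h_h)
  dM := X.d.restrict (d_mem_harmonicPart X.d_d)
  κM := H.κ.restrict H.κ_mem
  d_d := X.d_d
  homotopy x := by
    change X.d (H.h x) + H.h (X.d x) + harmonicProj X.d H.h x = x
    rw [harmonicProj_apply]
    abel
  h_i x := x.2.1
  p_h x := Subtype.ext (harmonicProj_h H.h_d_h H.h_h x)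
  h_h := H.h_h
  p_i x := Subtype.ext (harmonicProj_of_mem x.2)
  d_i _ := rfl
  leibniz := H.leibniz
  κ_mul := H.κ_mul
  κ_κ := H.κ_κ
  d_κ := H.d_κ
  h_κ := H.h_κ
  i_κ _ := rfl

theorem κM_apply (n : ℤ) (x : H.Space) (hx : x ∈ H.gr n) :
    H.contraction.κM x = koszulSign k n • x := Subtype.ext (H.κ_apply n x hx)

theorem smul_κM_mem {n : ℤ} {L : Submodule k H.Space} (hL : L ≤ H.gr n) (x : H.Space)
    (hx : x ∈ L) : H.contraction.κM x ∈ L := by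
  rw [H.κM_apply n x (hL hx)]
  exact L.smul_mem _ hx

theorem bar_mem_gr {w : List H.Space} {P n : ℤ} (hw : WordWeight (fun _ => H.gr) w P n) :
    H.contraction.bar w ∈ H.gr (n + 2 - w.length) :=
  H.contraction.bar_mem (G := fun _ => X.gr) (r := 0) (L := fun _ => H.gr)
    (fun _ _ _ _ _ _ hx hy => X.mul_mem _ _ _ _ hx hy) (fun _ => H.h_mem_gr)
    (fun _ _ _ hx => hx) (fun _ _ x hx => neg_mem (H.smul_κM_mem le_rfl x hx))
    (fun _ => H.proj_mem_gr) (fun _ n x hx => X.d_mem n x hx) hw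

theorem bar_mem_fil {w : List H.Space} {P n : ℤ} (hw : WordWeight H.fil w P n) :
    H.contraction.bar w ∈ H.fil (P + (2 - w.length) * r) (n + 2 - w.length) :=
  H.contraction.bar_mem (G := X.Fil) (r := r) (L := H.fil)
    (fun _ _ _ _ _ _ hx hy => X.Fil_mul _ _ _ _ _ _ hx hy) H.h_mem
    (fun _ _ _ hx => hx) (fun p n x hx => neg_mem (H.smul_κM_mem (H.fil_le_gr p n) x hx))
    H.proj_mem (fun p n x hx => X.Fil_anti _ (by omega : p + r ≤ p + r + 1)
      (H.d_mem p n x hx x.2)) hw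

theorem twist_mem_gr {w : List H.Space} {P n : ℤ} (hw : WordWeight (fun _ => H.gr) w P n) :
    H.contraction.twist w ∈ X.gr (n + 1 - w.length) :=
  H.contraction.twist_mem (G := fun _ => X.gr) (r := 0) (L := fun _ => H.gr)
    (fun _ _ _ _ _ _ hx hy => X.mul_mem _ _ _ _ hx hy) (fun _ => H.h_mem_gr)
    (fun _ _ _ hx => hx) (fun _ _ x hx => neg_mem (H.smul_κM_mem le_rfl x hx)) hw

theorem twist_mem_fil {w : List H.Space} {P n : ℤ} (hw : WordWeight H.fil w P n) :
    H.contraction.twist w ∈ X.Fil (P + (1 - w.length) * r) (n + 1 - w.length) :=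
  H.contraction.twist_mem (G := X.Fil) (r := r) (L := H.fil)
    (fun _ _ _ _ _ _ hx hy => X.Fil_mul _ _ _ _ _ _ hx hy) H.h_mem
    (fun _ _ _ hx => hx) (fun p n x hx => neg_mem (H.smul_κM_mem (H.fil_le_gr p n) x hx)) hw

/-- Desuspension only rescales homogeneous arguments, so it preserves weights. -/
theorem wordWeight_desuspended {L : ℤ → ℤ → Submodule k H.Space} (hL : ∀ p n, L p n ≤ H.gr n)
    {s : ℕ} {a : Fin s → H.Space} {P n : Fin s → ℤ} (h : ∀ i, a i ∈ L (P i) (n i)) :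
    WordWeight L (List.ofFn fun i => (H.contraction.κM ^ (s - 1 - (i : ℕ))) (a i))
      (∑ i, P i) (∑ i, n i) := by
  refine WordWeight.ofFn fun i => ?_
  rw [parity_pow H.κM_apply _ _ _ (hL _ _ (h i))]
  exact Submodule.smul_mem _ _ (h i)

/-- The transferred `A_∞`-structure on the harmonic part. -/
def ainf : AInfAlgebra k H.Space where
  gr := H.gr
  isInternal := H.gr_isInternal
  m := desuspend H.contraction.isMultilinear_bar H.contraction.κM
  m_zero := MultilinearMap.ext fun _ => H.contraction.bar_nil
  m_mem n a deg ha := by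
    have := H.bar_mem_gr (H.wordWeight_desuspended (L := fun _ => H.gr) (P := 0)
      (fun _ _ => le_rfl) ha)
    rw [List.length_ofFn] at this
    exact this
  stasheff n _ a deg ha := by
    rw [sum_desuspend_graft H.κM_apply _ _ a deg ha (fun r s _ => ?_) n]
    · rw [show -H.contraction.κM = H.contraction.σ from rfl, H.contraction.coder_bar, smul_zero]
    · have := H.bar_mem_gr (WordWeight.ofFn (L := fun _ => H.gr) (P := 0)
        (a := fun i : Fin s => a (r + i)) fun i => ha _)
      rwa [List.length_ofFn, Fin.sum_univ_eq_sum_range fun i => deg (r + i)] at this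

theorem ainf_d (x : H.Space) : H.ainf.d x = H.contraction.dM x := H.contraction.bar_singleton x

/-- The bigraded `A_∞`-algebra obtained from a splitting of the filtration of the harmonic part. -/
def minimalAlgebra : ErMinimalAlgebra k r H.Space where
  toAInfAlgebra := H.ainf
  bigr i := D i.1 (i.1 + i.2)
  bigr_isInternal := by
    have h := hD.isInternal
    rw [DirectSum.isInternal_submodule_iff_iSupIndep_and_iSup_eq_top] at h ⊢
    let e : ℤ × ℤ ≃ ℤ × ℤ :=
      { toFun := fun i => (i.1, i.1 + i.2)
        invFun := fun i => (i.1, i.2 - i.1)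
        left_inv := fun i => by simp
        right_inv := fun i => by simp }
    exact ⟨h.1.comp (f := e) e.injective,
      (Equiv.iSup_comp (g := fun i : ℤ × ℤ => D i.1 i.2) e).trans h.2⟩
  gr_eq n := by
    simp only [add_sub_cancel]
    exact hD.gr_eq n
  d_bidegree p q x hx := by
    have hx' : H.ainf.d x ∈ H.fil (p + r + 1) (p + q + 1) := by
      rw [ainf_d]
      exact H.d_mem p (p + q) x (hD.le _ _ hx) x.2
    refine SetLike.le_def.1 (le_of_eq (iSup_congr fun j => ?_)) (H.mem_iSup_of_mem_fil hD hx')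
    congr 1 <;> ring
  m_bidegree s hs p q a ha := by
    have h := H.bar_mem_fil (H.wordWeight_desuspended (L := H.fil) H.fil_le_gr
      fun i => hD.le _ _ (ha i))
    rw [List.length_ofFn] at h
    refine SetLike.le_def.1 (le_of_eq (iSup_congr fun j => ?_)) (H.mem_iSup_of_mem_fil hD h)
    dsimp only
    rw [Finset.sum_add_distrib]
    congr 1
    ring

/-- The transferred `A_∞`-morphism from the harmonic part to `A`. -/
def hom : AInfAlgebra.Hom (H.minimalAlgebra hD).toAInfAlgebra X.toAInfAlgebra where
  f := desuspend H.contraction.isMultilinear_twist H.contraction.κM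
  f_zero := MultilinearMap.ext fun _ => H.contraction.twist_nil
  f_mem n a deg ha := by
    have := H.twist_mem_gr (H.wordWeight_desuspended (L := fun _ => H.gr) (P := 0)
      (fun _ _ => le_rfl) ha)
    rw [List.length_ofFn] at this
    exact this
  relation n hn a deg ha := by
    refine (sum_desuspend_graft H.κM_apply H.contraction.isMultilinear_twist
      H.contraction.isMultilinear_bar a deg ha (fun r s _ => ?_) n).trans ?_
    · have := H.bar_mem_gr (WordWeight.ofFn (L := fun _ => H.gr) (P := 0)
        (a := fun i : Fin s => a (r + i)) fun i => ha _)
      rwa [List.length_ofFn, Fin.sum_univ_eq_sum_range fun i => deg (r + i)] at this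
    · refine Eq.trans ?_ (X.sum_composition H.κM_apply H.contraction.isMultilinear_twist
        H.contraction.twist_nil a deg ha n hn).symm
      rw [show -H.contraction.κM = H.contraction.σ from rfl, H.contraction.coder_twist]
      rfl

theorem hom_isErFiltered : IsErFiltered (N := H.minimalAlgebra hD) (H.hom hD) := by
  intro s _ p q a ha
  have h := H.twist_mem_fil (H.wordWeight_desuspended (L := H.fil) H.fil_le_gr
    fun i => hD.le _ _ (ha i))
  rw [List.length_ofFn, Finset.sum_add_distrib] at h
  convert h using 2
  · ring
  · rfl

theorem hom_linearPart (x : H.Space) : (H.hom hD).linearPart x = x :=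
  H.contraction.twist_singleton x

/-- The projection onto the harmonic part, as a morphism of filtered complexes. -/
def projHom : FilteredComplex.Hom X.toFilteredComplex (H.minimalAlgebra hD).toFilteredComplex where
  f := H.contraction.p
  comm x := (H.contraction.p_d x).trans (H.ainf_d _).symm
  map_mem p n x hx := by
    have h : H.contraction.p x ∈ H.gradedFiltration.Fil p n := H.proj_mem p n x hx
    rw [hD.fil_eq] at h
    change H.contraction.p x ∈ ⨆ q : ℤ, ⨆ _ : p ≤ q, D q (q + (n - q))
    simpa only [add_sub_cancel] using h

theorem isPageQuasiIso : (H.hom_isErFiltered hD).linearHom.IsPageQuasiIso r := by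
  refine FilteredComplex.Hom.isPageQuasiIso_of_homotopy _ (H.projHom hD) (fun x => ?_) r H.h
    H.h_mem fun y => ?_
  · change H.contraction.p ((H.hom hD).linearPart x) = x
    rw [hom_linearPart]
    exact H.contraction.p_i x
  · change X.d (H.h y) + H.h (X.d y) + (H.hom hD).linearPart (H.contraction.p y) = y
    rw [hom_linearPart]
    exact H.contraction.homotopy y

end MinimalHomotopy

end FilteredDGAlgebra

theorem theorem3p12 {k : Type u} [Field k] {A : Type v} [NonUnitalRing A] [Module k A]
    [IsScalarTower k A A] [SMulCommClass k A A] (X : FilteredDGAlgebra k A) (r : ℕ) :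
    ∃ (M : Type v) (_ : AddCommGroup M) (_ : Module k M), Nonempty (ErMinimalModel X r M) := by
  obtain ⟨H⟩ := X.exists_minimalHomotopy r
  obtain ⟨D, hD⟩ := H.gradedFiltration.exists_isSplitting
  exact ⟨H.Space, inferInstance, inferInstance,
    ⟨{ H.minimalAlgebra hD with
        hom := H.hom hD
        hom_filtered := H.hom_isErFiltered hD
        quasiIso := H.isPageQuasiIso hD }⟩⟩
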